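/- For sequences $\sigma, S$ over arbitrary alphabets write $\sigma\prec S$ if some (not necessarily contiguous) subsequence of $S$ equals $\sigma$ up to an injective renaming of symbols; let $|S|$ be the length of $S$ and $\|S\|$ the number of distinct symbols in $S$. A *block* is a sequence of pairwise distinct symbols; $S$ is *2-sparse* if no two adjacent symbols of $S$ are equal. For positive integers $n,m$ let $\lambda_5(n,m)$ be the maximum of $|S|$ over all sequences $S$ with $\|S\|=n$ and $abababa\nprec S$ that can be partitioned into at most $m$ (contiguous) blocks, and let $\lambda_5(n)$ be the maximum of $|S|$ over all 2-sparse sequences $S$ with $\|S\|=n$ and $abababa\nprec S$. Define Ackermann's function by $a_{1,j}=2^j$ for $j\ge 1$, $a_{i,1}=2$ for $i\ge 2$, and $a_{i,j}=w\cdot a_{i-1,w}$ with $w=a_{i,j-1}$ for $i,j\ge 2$, and its inverses by $$\alpha(n,m)=\min\{\, i\ge 1 : a_{i,j}\ge m\,\},\quad j=\max\{\lceil n/m\rceil,3\},\qquad \alpha(n)=\alpha(n,n).$$ **Theorem.** $\lambda_5(n,m)=\Omega\big(n\,\alpha(n,m)\,2^{\alpha(n,m)}\big)$ and $\lambda_5(n)=\Omega\big(n\,\alpha(n)\,2^{\alpha(n)}\big)$;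 that is, there are absolute constants $c,c'>0$ such that for all integers $n,m\ge 1$ $$\lambda_5(n,m)\ \ge\ c\, n\,\alpha(n,m)\,2^{\alpha(n,m)}\qquad\text{and}\qquad \lambda_5(n)\ \ge\ c'\, n\,\alpha(n)\,2^{\alpha(n)} .$$ -/

import Mathlib

namespace DavenportSchinzel

/-- Two sequences are isomorphic if they are equal up to a renaming of their alphabets. -/
def Isomorphic (σ τ : List ℕ) : Prop :=
  ∃ f : ℕ → ℕ, Set.InjOn f {x | x ∈ σ} ∧ τ = σ.map f

/-- `σ ≺ S`: the sequence `σ` is isomorphic to a (not necessarily contiguous) subsequence of `S`. -/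
def Occurs (σ S : List ℕ) : Prop :=
  ∃ τ : List ℕ, τ.Sublist S ∧ Isomorphic σ τ

/-- `‖S‖`, the number of distinct symbols occurring in `S`. -/
def alphabetSize (S : List ℕ) : ℕ := S.toFinset.card

/-- Equal symbols at distinct positions are at distance at least `k`. -/
def IsSparse (k : ℕ) (S : List ℕ) : Prop :=
  ∀ i j : Fin S.length, i < j → S.get i = S.get j → (i : ℕ) + k ≤ (j : ℕ)

/-- `S` can be partitioned into at most `m` blocks (contiguous pieces with distinct symbols). -/
def HasBlocks (m : ℕ) (S : List ℕ) : Prop :=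
  ∃ L : List (List ℕ), L.flatten = S ∧ L.length ≤ m ∧ ∀ β ∈ L, β.Nodup

/-- `Ex(σ, n, m)`: maximum length of a `σ`-free sequence over exactly `n` letters that can be
partitioned into at most `m` blocks. -/
noncomputable def exBlocked (σ : List ℕ) (n m : ℕ) : ℕ :=
  sSup {l : ℕ | ∃ S : List ℕ, ¬ Occurs σ S ∧ alphabetSize S = n ∧ HasBlocks m S ∧ S.length = l}

/-- `Ex(σ, n)`: maximum length of a `σ`-free, `‖σ‖`-sparse sequence over exactly `n` letters. -/
noncomputable def exSparse (σ : List ℕ) (n : ℕ) : ℕ :=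
  sSup {l : ℕ | ∃ S : List ℕ,
    ¬ Occurs σ S ∧ alphabetSize S = n ∧ IsSparse (alphabetSize σ) S ∧ S.length = l}

/-- The alternating sequence `0 1 0 1 0 ⋯` of length `k`. -/
def alternating (k : ℕ) : List ℕ := (List.range k).map (· % 2)

/-- `λ_s(n, m)`, the blocked extremal function of order-`s` Davenport–Schinzel sequences. -/
noncomputable def dsBlocked (s n m : ℕ) : ℕ := exBlocked (alternating (s + 2)) n m

/-- `λ_s(n)`, the extremal function of (2-sparse) order-`s` Davenport–Schinzel sequences. -/
noncomputable def dsSparse (s n : ℕ) : ℕ := exSparse (alternating (s + 2)) n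

/-- Ackermann's function `a_{i,j}` for `i, j ≥ 1`; the values at index `0` are not used. -/
def ackermann : ℕ → ℕ → ℕ
  | 0, _ => 0
  | 1, j => 2 ^ j
  | _ + 2, 0 => 0
  | _ + 2, 1 => 2
  | i + 2, j + 2 => ackermann (i + 2) (j + 1) * ackermann (i + 1) (ackermann (i + 2) (j + 1))
termination_by i j => (i, j)

/-- The two-argument inverse Ackermann function
`α(n, m) = min {i ≥ 1 | a_{i,j} ≥ m}` with `j = max {⌈n/m⌉, 3}`. -/
noncomputable def invAckermann₂ (n m : ℕ) : ℕ :=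
  sInf {i : ℕ | 1 ≤ i ∧ m ≤ ackermann i (max ⌈(n : ℚ) / (m : ℚ)⌉₊ 3)}

/-- `α(n) = α(n, n)`. -/
noncomputable def invAckermann (n : ℕ) : ℕ := invAckermann₂ n n

end DavenportSchinzel

/-! The sequences are grown as lists of tagged blocks. Each letter occurs exactly once in a block
tagged `true`, where it occurs first, and on average `v` times in blocks tagged `false`. Alternation
is measured by runs: if for every pair of letters the sequence splits into `K` segments that
alternately avoid one and the other, no alternation of length `K + 1` occurs.

One step joins a top list of multiplicity `u`, a middle list of multiplicity `v`, and two bottom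
lists. `compose` puts a copy of the middle list in place of every `true` block of the top list, and
replaces every `false` block `β` by `β` and its reverse; the multiplicity becomes `v + 2 * u`.
`shuffle` then spreads each block over a fresh copy of a bottom list, one letter at the end of each
block with the same tag, so that these blocks grow by one. Iterating over both block lengths gives
`row`, at the price of one row of Ackermann's function in the number of blocks.

After `shuffle`, letters of the composed list never share a block; the new shared blocks hold a
bottom letter `b` followed by an inserted letter `a`. `PairOK` records what surrounds such a block,
and `pair_compose` counts the runs when it is expanded at the next level. A `false` block gives
`ab|ba|ab|ba`, which is five runs because of the reversal. A `true` block is preceded by neither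
letter; the middle list contributes `2 * r + 1` runs that open and close with `b`, and one run of
`a` is added.

With `mirror` (three runs) in the middle there are at most five runs, and `v` becomes `2 * v + 1`:
this is `fourth`, with multiplicity `2 ^ i - 1`. With `fourth (i + 1)` in the middle there are at
most six runs, and the recurrence `2 * u + 2 ^ (i + 1) - 1` has the solution `(i - 1) * 2 ^ i + 1`:
this is `fifth`, and the source of the factor `α * 2 ^ α`.

The number of blocks of `fifth i` is bounded in row `i + 2` of Ackermann's function, so `i = α - 5`
leaves two rows to absorb all other factors. Disjoint copies then fill up `n` letters and `m` blocks
(`le_mul_dsBlocked`). Deleting at most one letter per block makes a blocked sequence 2-sparse. -/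

namespace DavenportSchinzel

/-! ### Calculus of runs -/

/-- `Fits ok p l`: the list `l` splits into consecutive runs, the elements of the `k`-th run being
compatible with the `k`-th letter of the pattern `p`. For the empty pattern, the elements of `l`
are compatible with every letter. -/
def Fits {E : Type*} (ok : Bool → E → Prop) : List Bool → List E → Prop
  | [], l => ∀ x ∈ l, ∀ c, ok c x
  | c :: p, l => ∃ l₁ l₂, l = l₁ ++ l₂ ∧ (∀ x ∈ l₁, ok c x) ∧ Fits ok p l₂

namespace Fits

variable {E E' : Type*} {ok : Bool → E → Prop} {ok' : Bool → E' → Prop}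

theorem of_forall {c : Bool} {l : List E} (h : ∀ x ∈ l, ok c x) : Fits ok [c] l :=
  ⟨l, [], by simp, h, by simp [Fits]⟩

theorem nil_right (p : List Bool) : Fits ok p ([] : List E) := by
  induction p with
  | nil => simp [Fits]
  | cons c p ih => exact ⟨[], [], rfl, by simp, ih⟩

/-- The empty pattern is neutral: a stretch compatible with every letter is absorbed by the run next
to it. -/
theorem append {p q : List Bool} {l l' : List E} (h : Fits ok p l) (h' : Fits ok q l') :
    Fits ok (p ++ q) (l ++ l') := by
  induction p generalizing l with
  | nil =>
    cases q with
    | nil =>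
      intro x hx
      rcases List.mem_append.1 hx with hx | hx
      exacts [h x hx, h' x hx]
    | cons c q =>
      obtain ⟨l₁, l₂, rfl, h₁, h₂⟩ := h'
      refine ⟨l ++ l₁, l₂, by simp, ?_, h₂⟩
      intro x hx
      rcases List.mem_append.1 hx with hx | hx
      exacts [h x hx c, h₁ x hx]
  | cons c p ih =>
    obtain ⟨l₁, l₂, rfl, h₁, h₂⟩ := h
    exact ⟨l₁, l₂ ++ l', by simp, h₁, ih h₂⟩

theorem pad_right {p : List Bool} {l : List E} (h : Fits ok p l) (q : List Bool) :
    Fits ok (p ++ q) l := by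
  simpa using h.append (nil_right (ok := ok) q)

theorem pad_left {p : List Bool} {l : List E} (h : Fits ok p l) (q : List Bool) :
    Fits ok (q ++ p) l := by
  simpa using (nil_right (ok := ok) q).append h

theorem collapse_head {c : Bool} {p : List Bool} {l : List E} (h : Fits ok (c :: c :: p) l) :
    Fits ok (c :: p) l := by
  obtain ⟨l₁, l₂, rfl, h₁, l₃, l₄, rfl, h₃, h₄⟩ := h
  refine ⟨l₁ ++ l₃, l₄, by simp, ?_, h₄⟩
  intro x hx
  rcases List.mem_append.1 hx with hx | hx
  exacts [h₁ x hx, h₃ x hx]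

theorem collapse {q : List Bool} {c : Bool} {p : List Bool} {l : List E}
    (h : Fits ok (q ++ c :: c :: p) l) : Fits ok (q ++ c :: p) l := by
  induction q generalizing l with
  | nil => exact collapse_head h
  | cons d q ih =>
    obtain ⟨l₁, l₂, rfl, h₁, h₂⟩ := h
    exact ⟨l₁, l₂, rfl, h₁, ih h₂⟩

theorem flatMap {p : List Bool} {l : List E} (h : Fits ok p l) (f : E → List E')
    (hf : ∀ x ∈ l, ∀ c, ok c x → ∀ y ∈ f x, ok' c y) : Fits ok' p (l.flatMap f) := by
  induction p generalizing l with
  | nil =>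
    intro y hy c
    obtain ⟨x, hx, hxy⟩ := List.mem_flatMap.1 hy
    exact hf x hx c (h x hx c) y hxy
  | cons c p ih =>
    obtain ⟨l₁, l₂, rfl, h₁, h₂⟩ := h
    refine ⟨l₁.flatMap f, l₂.flatMap f, by simp, ?_,
      ih h₂ fun x hx => hf x (List.mem_append_right _ hx)⟩
    intro y hy
    obtain ⟨x, hx, hxy⟩ := List.mem_flatMap.1 hy
    exact hf x (List.mem_append_left _ hx) c (h₁ x hx) y hxy

theorem map {p : List Bool} {l : List E} (h : Fits ok p l) (f : E → E')
    (hf : ∀ x ∈ l, ∀ c, ok c x → ok' c (f x)) : Fits ok' p (l.map f) := by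
  rw [List.map_eq_flatMap]
  exact h.flatMap _ fun x hx c hc y hy => by
    rw [List.mem_singleton.1 hy]; exact hf x hx c hc

theorem mono {ok' : Bool → E → Prop} {p : List Bool} {l : List E} (h : Fits ok p l)
    (hf : ∀ x ∈ l, ∀ c, ok c x → ok' c x) : Fits ok' p l := by
  simpa using h.map id hf

theorem sublist {p : List Bool} {l l' : List E} (h : Fits ok p l) (hl : l'.Sublist l) :
    Fits ok p l' := by
  induction p generalizing l l' with
  | nil => exact fun x hx => h x (hl.subset hx)
  | cons c p ih =>
    obtain ⟨l₁, l₂, rfl, h₁, h₂⟩ := h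
    obtain ⟨s₁, s₂, rfl, hs₁, hs₂⟩ := List.sublist_append_iff.1 hl
    exact ⟨s₁, s₂, rfl, fun x hx => h₁ x (hs₁.subset hx), ih h₂ hs₂⟩

theorem not_map {p : List Bool} {l : List E} (h : Fits ok p l) :
    Fits (fun c => ok (!c)) (p.map not) l := by
  induction p generalizing l with
  | nil => exact fun x hx c => h x hx _
  | cons c p ih =>
    obtain ⟨l₁, l₂, rfl, h₁, h₂⟩ := h
    exact ⟨l₁, l₂, rfl, by simpa using h₁, ih h₂⟩

/-- If `x :: l` fits `p`, then some pattern `p'` is fitted by `l` and remains available after any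
first element that is compatible with all the letters `x` is compatible with. -/
theorem of_cons {p : List Bool} {x : E} {l : List E} (h : Fits ok p (x :: l)) :
    ∃ p', Fits ok p' l ∧ ∀ (y : E') (l' : List E'), (∀ c, ok c x → ok' c y) →
      Fits ok' p' l' → Fits ok' p (y :: l') := by
  induction p generalizing x l with
  | nil =>
    refine ⟨[], fun z hz => h z (List.mem_cons_of_mem _ hz), fun y l' hy hl' z hz => ?_⟩
    rcases List.mem_cons.1 hz with rfl | hz
    exacts [fun c => hy c (h x (by simp) c), hl' z hz]
  | cons c p ih =>
    obtain ⟨l₁, l₂, hl, h₁, h₂⟩ := h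
    cases l₁ with
    | nil =>
      rw [List.nil_append] at hl
      subst hl
      obtain ⟨p', hp', hp⟩ := ih h₂
      exact ⟨p', hp', fun y l' hy hl' => (hp y l' hy hl').pad_left [c]⟩
    | cons z l₁ =>
      obtain ⟨rfl, rfl⟩ := List.cons.inj hl
      refine ⟨c :: p, ⟨l₁, l₂, rfl, fun w hw => h₁ w (List.mem_cons_of_mem _ hw), h₂⟩, ?_⟩
      rintro y _ hy ⟨m₁, m₂, rfl, hm₁, hm₂⟩
      refine ⟨y :: m₁, m₂, rfl, fun w hw => ?_, hm₂⟩
      rcases List.mem_cons.1 hw with rfl | hw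
      exacts [hy c (h₁ x (by simp)), hm₁ w hw]

/-- If the first letter of the pattern is incompatible with the first element, it may be dropped. -/
theorem drop_head {c : Bool} {p : List Bool} {x : E} {l : List E} (h : Fits ok (c :: p) (x :: l))
    (hx : ¬ ok c x) : Fits ok p (x :: l) := by
  obtain ⟨l₁, l₂, hl, h₁, h₂⟩ := h
  cases l₁ with
  | nil => rw [List.nil_append] at hl; rwa [hl]
  | cons z l₁ =>
    obtain ⟨rfl, rfl⟩ := List.cons.inj hl
    exact absurd (h₁ x (by simp)) hx

end Fits

/-- The pattern `c, !c, c, …` of length `k`. -/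
def alt : Bool → ℕ → List Bool
  | _, 0 => []
  | c, k + 1 => c :: alt (!c) k

@[simp] theorem alt_length (c : Bool) (k : ℕ) : (alt c k).length = k := by
  induction k generalizing c with
  | zero => rfl
  | succ k ih => simp [alt, ih]

theorem alt_map_not (c : Bool) (k : ℕ) : (alt c k).map not = alt (!c) k := by
  induction k generalizing c with
  | zero => rfl
  | succ k ih => simp [alt, ih]

theorem alt_prefix (c : Bool) {k l : ℕ} (h : k ≤ l) : ∃ q, alt c l = alt c k ++ q := by
  induction k generalizing c l with
  | zero => exact ⟨_, rfl⟩
  | succ k ih =>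
    obtain ⟨l, rfl⟩ : ∃ l', l = l' + 1 := ⟨l - 1, by omega⟩
    obtain ⟨q, hq⟩ := ih (!c) (Nat.le_of_succ_le_succ h)
    exact ⟨q, by simp [alt, hq]⟩

theorem Fits.alt_le {E : Type*} {ok : Bool → E → Prop} {c : Bool} {k l : ℕ} {L : List E}
    (h : Fits ok (alt c k) L) (hkl : k ≤ l) : Fits ok (alt c l) L := by
  obtain ⟨q, hq⟩ := alt_prefix c hkl
  rw [hq]
  exact h.pad_right q

/-- An odd alternating pattern followed by its own last letter and the other one. -/
theorem alt_odd_append (c : Bool) (r : ℕ) :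
    ∃ q, alt c (2 * r + 1) = q ++ [c] ∧ alt c (2 * r + 2) = q ++ [c, !c] := by
  induction r with
  | zero => exact ⟨[], rfl, rfl⟩
  | succ r ih =>
    obtain ⟨q, h₁, h₂⟩ := ih
    refine ⟨c :: (!c) :: q, ?_, ?_⟩
    · rw [show 2 * (r + 1) + 1 = (2 * r + 1) + 1 + 1 by ring]
      simp [alt, ← h₁]
    · rw [show 2 * (r + 1) + 2 = (2 * r + 2) + 1 + 1 by ring]
      simp [alt, ← h₂]

theorem Fits.alt_odd_append {E : Type*} {ok : Bool → E → Prop} {c : Bool} {r : ℕ} {l l' : List E}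
    (h : Fits ok (alt c (2 * r + 1)) l) (htail : Fits ok [c, !c] l') :
    Fits ok (alt c (2 * r + 2)) (l ++ l') := by
  obtain ⟨q, h₁, h₂⟩ := DavenportSchinzel.alt_odd_append c r
  rw [h₂]
  apply Fits.collapse
  rw [h₁] at h
  simpa using h.append htail

/-! ### Tagged blocks, frames and pairs of letters -/

/-- Compatibility of a letter with the symbol pair `a, b`: `true` excludes `b`,
`false` excludes `a`. -/
def ltr (a b : ℕ) (c : Bool) (x : ℕ) : Prop := x ≠ bif c then b else a

/-- A tagged block: the tag `true` marks the blocks which hold first occurrences. -/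
abbrev Block := Bool × List ℕ

/-- Compatibility of a block with the symbol pair `a, b`: `true` excludes `b`,
`false` excludes `a`. -/
def blk (a b : ℕ) (c : Bool) (B : Block) : Prop := (bif c then b else a) ∉ B.2

theorem Fits.blk_swap {a b : ℕ} {p : List Bool} {L : List Block} (h : Fits (blk a b) p L) :
    Fits (blk b a) (p.map not) L :=
  h.not_map.mono fun _ _ c hc => by cases c <;> exact hc

theorem Fits.ltr_swap {a b : ℕ} {p : List Bool} {l : List ℕ} (h : Fits (ltr a b) p l) :
    Fits (ltr b a) (p.map not) l :=
  h.not_map.mono fun _ _ c hc => by cases c <;> exact hc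

/-- The underlying sequence of a list of blocks. -/
def flat (L : List Block) : List ℕ := L.flatMap Prod.snd

theorem mem_flat {x : ℕ} {L : List Block} : x ∈ flat L ↔ ∃ B ∈ L, x ∈ B.2 := List.mem_flatMap

@[simp] theorem flat_nil : flat [] = [] := rfl

@[simp] theorem flat_cons (B : Block) (L : List Block) : flat (B :: L) = B.2 ++ flat L := by
  simp [flat]

@[simp] theorem flat_append (L L' : List Block) : flat (L ++ L') = flat L ++ flat L' := by
  simp [flat]

theorem Fits.flat {a b : ℕ} {p : List Bool} {L : List Block} (h : Fits (blk a b) p L) :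
    Fits (ltr a b) p (flat L) :=
  h.flatMap _ fun _ _ _ hB _ hy hyc => hB (hyc ▸ hy)

/-- The letters in the blocks with tag `t`. -/
def letters (t : Bool) (L : List Block) : List ℕ := L.flatMap fun B => if B.1 = t then B.2 else []

/-- The number of blocks with tag `t`. -/
def numBlocks (t : Bool) (L : List Block) : ℕ := L.countP fun B => B.1 = t

@[simp] theorem letters_nil (t : Bool) : letters t [] = [] := rfl

@[simp] theorem letters_cons (t : Bool) (B : Block) (L : List Block) :
    letters t (B :: L) = (if B.1 = t then B.2 else []) ++ letters t L := by
  simp [letters]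

@[simp] theorem letters_append (t : Bool) (L L' : List Block) :
    letters t (L ++ L') = letters t L ++ letters t L' := by
  simp [letters]

theorem mem_letters {t : Bool} {x : ℕ} {L : List Block} :
    x ∈ letters t L ↔ ∃ B ∈ L, B.1 = t ∧ x ∈ B.2 := by
  simp only [letters, List.mem_flatMap]
  refine exists_congr fun B => and_congr_right fun _ => ?_
  split_ifs with h <;> simp [h]

theorem letters_sublist_flat (t : Bool) (L : List Block) : (letters t L).Sublist (flat L) := by
  induction L with
  | nil => simp
  | cons B L ih =>
    rw [letters_cons, flat_cons]
    refine List.Sublist.append ?_ ih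
    split_ifs <;> simp

theorem length_letters {t : Bool} {j : ℕ} {L : List Block}
    (h : ∀ B ∈ L, B.1 = t → B.2.length = j) : (letters t L).length = numBlocks t L * j := by
  induction L with
  | nil => simp [numBlocks]
  | cons B L ih =>
    have ih := ih fun B hB => h B (List.mem_cons_of_mem _ hB)
    have hB := h B (by simp)
    rw [letters_cons, List.length_append, ih, numBlocks, numBlocks, List.countP_cons]
    by_cases ht : B.1 = t
    · simp [ht, hB ht]; ring
    · simp [ht]

theorem length_flat (L : List Block) :
    (flat L).length = (letters true L).length + (letters false L).length := by
  induction L with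
  | nil => simp
  | cons B L ih =>
    rcases B with ⟨_ | _, β⟩ <;> simp [ih] <;> ring

theorem numBlocks_add (L : List Block) : numBlocks true L + numBlocks false L = L.length := by
  induction L with
  | nil => simp [numBlocks]
  | cons B L ih =>
    rcases B with ⟨_ | _, β⟩ <;> simp [numBlocks] at ih ⊢ <;> omega

theorem numBlocks_le_length (t : Bool) (L : List Block) : numBlocks t L ≤ L.length :=
  List.countP_le_length

/-- The shape of the lists of blocks that are used here: blocks consist of distinct letters and
have length `j t` when they have tag `t`; the letters of a block tagged `true` have not occurred
before; every letter has such an occurrence; and on average a letter has `v` other occurrences. -/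
structure Frame (v : ℕ) (j : Bool → ℕ) (L : List Block) : Prop where
  nodup : ∀ B ∈ L, B.2.Nodup
  len : ∀ B ∈ L, B.2.length = j B.1
  first : L.Pairwise fun B B' => B'.1 = true → B.2.Disjoint B'.2
  cover : ∀ x ∈ flat L, x ∈ letters true L
  count : (letters false L).length = v * (letters true L).length

/-- The possible interplay of two letters `a` and `b`: either no block contains both, and the
blocks form at most `K` runs starting with a run of `a`'s, or exactly one block contains both, and
the occurrences outside of it are restricted. -/
def PairOK (K : ℕ) (L : List Block) (a b : ℕ) : Prop :=
  Fits (blk a b) (alt true K) L ∨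
  (∃ L₁ β L₂, L = L₁ ++ (true, β) :: L₂ ∧ [b, a].Sublist β ∧
    Fits (blk a b) [] L₁ ∧ Fits (blk a b) [false, true] L₂) ∨
  (∃ L₁ β L₂, L = L₁ ++ (false, β) :: L₂ ∧ [b, a].Sublist β ∧
    Fits (blk a b) [true, false] L₁ ∧ Fits (blk a b) [false, true] L₂)

theorem nodup_letters_true {L : List Block} (hn : ∀ B ∈ L, B.2.Nodup)
    (hf : L.Pairwise fun B B' => B'.1 = true → B.2.Disjoint B'.2) : (letters true L).Nodup := by
  induction L with
  | nil => simp
  | cons B L ih =>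
    rw [List.pairwise_cons] at hf
    have ih := ih (fun B hB => hn B (List.mem_cons_of_mem _ hB)) hf.2
    rw [letters_cons]
    split_ifs with h
    · refine List.Nodup.append (hn B (by simp)) ih fun x hx hx' => ?_
      obtain ⟨B', hB', ht, hxB⟩ := mem_letters.1 hx'
      exact hf.1 B' hB' ht hx hxB
    · simpa using ih

theorem Frame.nodup_letters {v : ℕ} {j : Bool → ℕ} {L : List Block} (h : Frame v j L) :
    (letters true L).Nodup := nodup_letters_true h.nodup h.first

/-! ### Copies and composition -/

/-- Renaming the letters. -/
def mapLetters (f : ℕ → ℕ) (L : List Block) : List Block := L.map fun B => (B.1, B.2.map f)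

theorem flat_mapLetters (f : ℕ → ℕ) (L : List Block) : flat (mapLetters f L) = (flat L).map f := by
  induction L with
  | nil => rfl
  | cons B L ih => simp [mapLetters] at ih ⊢; exact ih

theorem letters_mapLetters (f : ℕ → ℕ) (t : Bool) (L : List Block) :
    letters t (mapLetters f L) = (letters t L).map f := by
  induction L with
  | nil => rfl
  | cons B L ih =>
    simp only [mapLetters] at ih
    rw [mapLetters, List.map_cons, letters_cons, ih, letters_cons, List.map_append]
    split_ifs <;> simp

theorem numBlocks_mapLetters (f : ℕ → ℕ) (t : Bool) (L : List Block) :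
    numBlocks t (mapLetters f L) = numBlocks t L := by
  simp [numBlocks, mapLetters, List.countP_map, Function.comp_def]

theorem Frame.mapLetters {v : ℕ} {j : Bool → ℕ} {L : List Block} (h : Frame v j L) {f : ℕ → ℕ}
    (hf : ∀ x ∈ flat L, ∀ y ∈ flat L, f x = f y → x = y) : Frame v j (mapLetters f L) where
  nodup B hB := by
    obtain ⟨B, hB', rfl⟩ := List.mem_map.1 hB
    exact (h.nodup B hB').map_on fun x hx y hy =>
      hf x (mem_flat.2 ⟨B, hB', hx⟩) y (mem_flat.2 ⟨B, hB', hy⟩)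
  len B hB := by
    obtain ⟨B, hB', rfl⟩ := List.mem_map.1 hB
    simpa using h.len B hB'
  first := by
    rw [DavenportSchinzel.mapLetters, List.pairwise_map]
    refine h.first.imp_of_mem fun {B B'} hB hB' hd ht => ?_
    intro x hx hx'
    obtain ⟨y, hy, rfl⟩ := List.mem_map.1 hx
    obtain ⟨z, hz, hzy⟩ := List.mem_map.1 hx'
    have := hf z (mem_flat.2 ⟨B', hB', hz⟩) y (mem_flat.2 ⟨B, hB, hy⟩) hzy
    exact hd ht hy (this ▸ hz)
  cover x hx := by
    rw [flat_mapLetters] at hx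
    rw [letters_mapLetters]
    obtain ⟨y, hy, rfl⟩ := List.mem_map.1 hx
    exact List.mem_map_of_mem (h.cover y hy)
  count := by simpa [letters_mapLetters] using h.count

/-- The renaming that carries `l` to `β`. -/
def transfer (l β : List ℕ) (x : ℕ) : ℕ := β.getD (l.idxOf x) 0

theorem map_transfer {l β : List ℕ} (hl : l.Nodup) (h : l.length = β.length) :
    l.map (transfer l β) = β := by
  apply List.ext_getElem (by simpa using h)
  intro k h₁ h₂
  have hk : k < l.length := by simpa using h₁
  simp [transfer, hl.idxOf_getElem k hk, h₂]

theorem transfer_inj {l β : List ℕ} (hβ : β.Nodup) (h : l.length = β.length) {x y : ℕ}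
    (hx : x ∈ l) (hy : y ∈ l) (hxy : transfer l β x = transfer l β y) : x = y := by
  have h₁ : l.idxOf x < β.length := h ▸ List.idxOf_lt_length_iff.2 hx
  have h₂ : l.idxOf y < β.length := h ▸ List.idxOf_lt_length_iff.2 hy
  simp only [transfer, List.getD_eq_getElem _ _ h₁, List.getD_eq_getElem _ _ h₂] at hxy
  exact (List.idxOf_inj hx).1 ((hβ.getElem_inj_iff).1 hxy)

/-- The copy of `M` over the alphabet `β`, the letters of `M` being ordered by first occurrence. -/
def instantiate (M : List Block) (β : List ℕ) : List Block :=
  mapLetters (transfer (letters true M) β) M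

/-- Blocks tagged `true` are replaced by copies of `M`, and other blocks are followed by their
reverses. -/
def expand (M : List Block) (B : Block) : List Block :=
  if B.1 = true then instantiate M B.2 else [(false, B.2), (false, B.2.reverse)]

/-- The expansion of all the blocks of a list. -/
def compose (M L : List Block) : List Block := L.flatMap (expand M)

section Instantiate

variable {v : ℕ} {w : Bool → ℕ} {M : List Block} {β : List ℕ}

theorem letters_instantiate (hM : Frame v w M) (h : (letters true M).length = β.length) :
    letters true (instantiate M β) = β := by
  rw [instantiate, letters_mapLetters, map_transfer hM.nodup_letters h]

theorem frame_instantiate (hM : Frame v w M) (hβ : β.Nodup)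
    (h : (letters true M).length = β.length) : Frame v w (instantiate M β) :=
  hM.mapLetters fun x hx y hy => transfer_inj hβ h (hM.cover x hx) (hM.cover y hy)

/-- `transfer` carries the order of first occurrence in `M` to the order in `β`, so the order of a
pair in `β` decides which letter opens the pattern. -/
theorem fits_instantiate (hM : Frame v w M) (hβ : β.Nodup)
    (h : (letters true M).length = β.length) {p : List Bool}
    (hp : ∀ a b, [a, b].Sublist (letters true M) → Fits (ltr a b) p (flat M)) {a b : ℕ}
    (hab : [a, b].Sublist β) : Fits (ltr a b) p (flat (instantiate M β)) := by
  rw [← map_transfer hM.nodup_letters h] at hab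
  obtain ⟨l, hl, hab⟩ := List.sublist_map_iff.1 hab
  obtain ⟨a', b', rfl⟩ : ∃ a' b', l = [a', b'] := by
    have : l.length = 2 := by simpa using (congrArg List.length hab).symm
    exact List.length_eq_two.1 this
  simp only [List.map_cons, List.map_nil, List.cons.injEq, and_true] at hab
  obtain ⟨rfl, rfl⟩ := hab
  rw [instantiate, flat_mapLetters]
  refine (hp a' b' hl).map _ fun x hx c hc hxc => hc ?_
  have ha : a' ∈ letters true M := hl.subset (by simp)
  have hb : b' ∈ letters true M := hl.subset (by simp)
  cases c
  · exact transfer_inj hβ h (hM.cover x hx) ha hxc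
  · exact transfer_inj hβ h (hM.cover x hx) hb hxc

end Instantiate

section Compose

variable {v u : ℕ} {w j : Bool → ℕ} {M L : List Block}

theorem flat_expand_subset (hM : Frame v w M) {B : Block}
    (hB : B.1 = true → B.2.length = (letters true M).length) :
    ∀ B' ∈ expand M B, ∀ x ∈ B'.2, x ∈ B.2 := by
  intro B' hB' x hx
  rw [expand] at hB'
  split_ifs at hB' with h
  · have hlen := (hB h).symm
    rw [← letters_instantiate hM hlen]
    have hx : x ∈ flat (instantiate M B.2) := mem_flat.2 ⟨B', hB', hx⟩
    rw [instantiate, flat_mapLetters] at hx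
    rw [instantiate, letters_mapLetters]
    obtain ⟨y, hy, rfl⟩ := List.mem_map.1 hx
    exact List.mem_map_of_mem (hM.cover y hy)
  · simp only [List.mem_cons, List.not_mem_nil, or_false] at hB'
    rcases hB' with rfl | rfl <;> simpa using hx

/-- Source of the recurrence `v + 2 * u`: the copies of `M` bring `v` occurrences per letter, and
the old ones are doubled by the reversal. -/
theorem length_letters_compose (hM : Frame v w M)
    (hL : ∀ B ∈ L, B.1 = true → B.2.length = (letters true M).length) :
    (letters true (compose M L)).length = (letters true L).length ∧
    (letters false (compose M L)).length =
      v * (letters true L).length + 2 * (letters false L).length := by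
  induction L with
  | nil => simp [compose]
  | cons B L ih =>
    obtain ⟨ih₁, ih₂⟩ := ih fun B hB => hL B (List.mem_cons_of_mem _ hB)
    have hB := hL B (by simp)
    rw [compose] at ih₁ ih₂ ⊢
    rw [List.flatMap_cons, letters_append, letters_append, List.length_append, List.length_append,
      ih₁, ih₂]
    rcases B with ⟨_ | _, β⟩
    · simp [expand]; ring
    · have hlen : (letters true M).length = β.length := (hB rfl).symm
      have h : (letters false (instantiate M β)).length = v * β.length := by
        rw [instantiate, letters_mapLetters, List.length_map, hM.count, hlen]
      simp [expand, letters_instantiate hM hlen, h]; ring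

theorem frame_compose (hM : Frame v w M) (hL : Frame u j L)
    (hj : j true = (letters true M).length) (hw : j false = w false) :
    Frame (v + 2 * u) w (compose M L) := by
  have hlen : ∀ B ∈ L, B.1 = true → B.2.length = (letters true M).length := fun B hB h => by
    rw [hL.len B hB, h, hj]
  refine ⟨fun B' hB' => ?_, fun B' hB' => ?_, ?_, fun x hx => ?_, ?_⟩
  · obtain ⟨B, hB, hB'⟩ := List.mem_flatMap.1 hB'
    rw [expand] at hB'
    split_ifs at hB' with h
    · exact (frame_instantiate hM (hL.nodup B hB) (hlen B hB h).symm).nodup B' hB'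
    · simp only [List.mem_cons, List.not_mem_nil, or_false] at hB'
      rcases hB' with rfl | rfl <;> simpa using hL.nodup B hB
  · obtain ⟨B, hB, hB'⟩ := List.mem_flatMap.1 hB'
    rw [expand] at hB'
    split_ifs at hB' with h
    · exact (frame_instantiate hM (hL.nodup B hB) (hlen B hB h).symm).len B' hB'
    · have hB2 : B.2.length = w false := by rw [hL.len B hB, Bool.eq_false_of_not_eq_true h, hw]
      simp only [List.mem_cons, List.not_mem_nil, or_false] at hB'
      rcases hB' with rfl | rfl <;> simpa using hB2
  · rw [compose, List.pairwise_flatMap]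
    constructor
    · intro B hB
      rw [expand]
      split_ifs with h
      · exact (frame_instantiate hM (hL.nodup B hB) (hlen B hB h).symm).first
      · simp
    · refine hL.first.imp_of_mem fun {B₁ B₂} h₁ h₂ hd B₁' h₁' B₂' h₂' ht x hx hx' => ?_
      refine hd ?_ (flat_expand_subset hM (hlen B₁ h₁) _ h₁' x hx)
        (flat_expand_subset hM (hlen B₂ h₂) _ h₂' x hx')
      by_contra h
      rw [expand, if_neg h] at h₂'
      simp only [List.mem_cons, List.not_mem_nil, or_false] at h₂'
      rcases h₂' with rfl | rfl <;> simp at ht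
  · obtain ⟨B', hB', hx⟩ := mem_flat.1 hx
    obtain ⟨B, hB, hB'⟩ := List.mem_flatMap.1 hB'
    obtain ⟨A, hA, ht, hxA⟩ := mem_letters.1 (hL.cover x (mem_flat.2
      ⟨B, hB, flat_expand_subset hM (hlen B hB) _ hB' x hx⟩))
    rw [← letters_instantiate hM (hlen A hA ht).symm] at hxA
    obtain ⟨A', hA', ht', hxA'⟩ := mem_letters.1 hxA
    refine mem_letters.2 ⟨A', List.mem_flatMap.2 ⟨A, hA, ?_⟩, ht', hxA'⟩
    rwa [expand, if_pos ht]
  · obtain ⟨h₁, h₂⟩ := length_letters_compose hM hlen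
    rw [h₂, h₁, hL.count]; ring

/-- Expansion introduces no letter that is not in the expanded block, so runs of blocks remain runs.
-/
theorem fits_compose {a b : ℕ} {p : List Bool} (hM : Frame v w M)
    (hlen : ∀ B ∈ L, B.1 = true → B.2.length = (letters true M).length)
    (h : Fits (blk a b) p L) : Fits (ltr a b) p (flat (compose M L)) := by
  refine Fits.flat (Fits.flatMap h _ fun B hB c hc B' hB' hx => ?_)
  exact hc (flat_expand_subset hM (hlen B hB) B' hB' _ hx)

theorem fits_of_nodup {l : List ℕ} {x y : ℕ} (hl : l.Nodup) (hxy : [x, y].Sublist l) :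
    Fits (ltr x y) [true, false] l := by
  obtain ⟨s, t, rfl, hs, ht⟩ := List.append_sublist_iff.1 (show ([x] ++ [y]).Sublist l from hxy)
  have hd := List.disjoint_of_nodup_append hl
  refine Fits.append (p := [true]) (q := [false]) (Fits.of_forall fun z hz hzy => ?_)
    (Fits.of_forall fun z hz hzx => ?_)
  · exact hd hz (by simpa [hzy] using ht)
  · exact hd (by simpa [hzx] using hs) hz

/-- The number of runs of a pair of letters after composition. -/
theorem pair_compose {K r : ℕ} (hK : 5 ≤ K) (hr : 2 * r + 2 ≤ K) (hM : Frame v w M)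
    (hmid : ∀ a b, [a, b].Sublist (letters true M) →
      Fits (ltr a b) (alt true (2 * r + 1)) (flat M))
    (hL : Frame u j L) (hj : j true = (letters true M).length) {a b : ℕ} (h : PairOK K L a b) :
    Fits (ltr a b) (alt true K) (flat (compose M L)) ∨
      Fits (ltr b a) (alt true K) (flat (compose M L)) := by
  have hlen : ∀ B ∈ L, B.1 = true → B.2.length = (letters true M).length := fun B hB h => by
    rw [hL.len B hB, h, hj]
  rcases h with h | ⟨L₁, β, L₂, rfl, hβ, h₁, h₂⟩ | ⟨L₁, β, L₂, rfl, hβ, h₁, h₂⟩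
  · exact Or.inl (fits_compose hM hlen h)
  · right
    have h₁ := fits_compose hM (fun B hB => hlen B (List.mem_append_left _ hB)) h₁.blk_swap
    have h₂ := fits_compose hM
      (fun B hB => hlen B (List.mem_append_right _ (List.mem_cons_of_mem _ hB))) h₂.blk_swap
    have hmem : (true, β) ∈ L₁ ++ (true, β) :: L₂ := by simp
    have h₃ := fits_instantiate hM (hL.nodup _ hmem) (hlen _ hmem rfl).symm hmid hβ
    -- The copy of `M` opens and closes with a run of `b`. The rest is a run of `b`, which merges
    -- with it, and a run of `a`: in all `2 * r + 2`.
    have h₄ := h₁.append (h₃.alt_odd_append h₂)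
    refine Fits.alt_le ?_ hr
    simpa [compose, expand] using h₄
  · left
    have h₁ := fits_compose hM (fun B hB => hlen B (List.mem_append_left _ hB)) h₁
    have h₂ := fits_compose hM
      (fun B hB => hlen B (List.mem_append_right _ (List.mem_cons_of_mem _ hB))) h₂
    have hmem : (false, β) ∈ L₁ ++ (false, β) :: L₂ := by simp
    have h₃ := (fits_of_nodup (hL.nodup _ hmem) hβ).ltr_swap
    have h₄ := fits_of_nodup (l := β.reverse) (by simpa using hL.nodup _ hmem) (by
      simpa using hβ.reverse)
    -- The pieces run `ab`, `ba`, `ab`, `ba`; each junction merges two runs and leaves `ababa`.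
    -- Repeating the block without reversal would give seven runs.
    have h₅ := h₁.append ((h₃.append h₄).append h₂)
    simp only [List.map_cons, List.map_nil, Bool.not_true, Bool.not_false, List.cons_append,
      List.nil_append] at h₅
    have h₆ := Fits.collapse (q := [true]) h₅
    have h₇ := Fits.collapse (q := [true, false]) h₆
    have h₈ := Fits.collapse (q := [true, false, true]) h₇
    refine Fits.alt_le (k := 5) ?_ hK
    simpa [compose, expand, alt] using h₈

end Compose

/-! ### Insertion of letters into blocks -/

/-- Append the successive letters of `β` to the successive blocks of `K` with tag `t`. -/
def ins (t : Bool) : List ℕ → List Block → List Block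
  | _, [] => []
  | [], B :: K => B :: K
  | x :: β, B :: K => if B.1 = t then (B.1, B.2 ++ [x]) :: ins t β K else B :: ins t (x :: β) K

section Ins

variable {t : Bool}

@[simp] theorem ins_nil_left (K : List Block) : ins t [] K = K := by
  cases K <;> rfl

/-- A block of `ins t β K` is a block of `K`, or such a block with a letter of `β` appended. -/
theorem mem_ins {β : List ℕ} {K : List Block} {B : Block} (h : B ∈ ins t β K) :
    B ∈ K ∨ ∃ B₀ ∈ K, ∃ x ∈ β, B₀.1 = t ∧ B = (B₀.1, B₀.2 ++ [x]) := by
  induction K generalizing β with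
  | nil => cases β <;> simp [ins] at h
  | cons B₀ K ih =>
    cases β with
    | nil => exact Or.inl (by simpa [ins] using h)
    | cons x β =>
      rw [ins] at h
      split_ifs at h with ht
      · rcases List.mem_cons.1 h with rfl | h
        · exact Or.inr ⟨B₀, by simp, x, by simp, ht, rfl⟩
        · rcases ih h with h | ⟨B₁, hB₁, y, hy, h⟩
          · exact Or.inl (List.mem_cons_of_mem _ h)
          · exact Or.inr ⟨B₁, List.mem_cons_of_mem _ hB₁, y, List.mem_cons_of_mem _ hy, h⟩
      · rcases List.mem_cons.1 h with rfl | h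
        · exact Or.inl (by simp)
        · rcases ih h with h | ⟨B₁, hB₁, y, hy, h⟩
          · exact Or.inl (List.mem_cons_of_mem _ h)
          · exact Or.inr ⟨B₁, List.mem_cons_of_mem _ hB₁, y, hy, h⟩

theorem mem_flat_ins {β : List ℕ} {K : List Block} {x : ℕ} (h : x ∈ flat (ins t β K)) :
    x ∈ flat K ∨ x ∈ β := by
  obtain ⟨B, hB, hx⟩ := mem_flat.1 h
  rcases mem_ins hB with hB | ⟨B₀, hB₀, y, hy, -, rfl⟩
  · exact Or.inl (mem_flat.2 ⟨B, hB, hx⟩)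
  · rcases List.mem_append.1 hx with hx | hx
    · exact Or.inl (mem_flat.2 ⟨B₀, hB₀, hx⟩)
    · rw [List.mem_singleton.1 hx]; exact Or.inr hy

/-- Inserting at the blocks around the position of a given letter. -/
theorem ins_split {β₁ β₂ : List ℕ} {x : ℕ} {K : List Block}
    (h : (β₁ ++ x :: β₂).length = numBlocks t K) :
    ∃ K₁ γ K₂, K = K₁ ++ (t, γ) :: K₂ ∧
      ins t (β₁ ++ x :: β₂) K = ins t β₁ K₁ ++ (t, γ ++ [x]) :: ins t β₂ K₂ := by
  induction K generalizing β₁ with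
  | nil => simp [numBlocks] at h
  | cons B K ih =>
    by_cases ht : B.1 = t
    · cases β₁ with
      | nil => exact ⟨[], B.2, K, by simp [← ht], by simp [ins, ht]⟩
      | cons y β₁ =>
        obtain ⟨K₁, γ, K₂, rfl, h'⟩ := ih (β₁ := β₁) (by simpa [numBlocks, ht] using h)
        exact ⟨B :: K₁, γ, K₂, rfl, by
          rw [List.cons_append, ins, if_pos ht, h', ins, if_pos ht]; rfl⟩
    · obtain ⟨K₁, γ, K₂, rfl, h'⟩ := ih (β₁ := β₁) (by simpa [numBlocks, ht] using h)
      refine ⟨B :: K₁, γ, K₂, rfl, ?_⟩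
      cases β₁ with
      | nil => simp only [List.nil_append, ins_nil_left] at h' ⊢; simp [ins, ht, h']
      | cons y β₁ =>
        rw [List.cons_append] at h' ⊢
        rw [ins, if_neg ht, h', ins, if_neg ht]; rfl

/-- Only a permutation, since the inserted letters come to stand between the old ones. -/
theorem letters_ins_self {β : List ℕ} {K : List Block} (h : β.length = numBlocks t K) :
    (letters t (ins t β K)).Perm (β ++ letters t K) := by
  induction K generalizing β with
  | nil =>
    have : β = [] := by simpa [numBlocks] using h
    subst this; simp
  | cons B K ih =>
    by_cases ht : B.1 = t
    · cases β with
      | nil => simp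
      | cons x β =>
        have ih := ih (β := β) (by simpa [numBlocks, ht] using h)
        rw [ins, if_pos ht, letters_cons, letters_cons, if_pos ht, if_pos ht]
        simp only [List.append_assoc, List.cons_append, List.nil_append]
        refine List.perm_middle.trans (List.Perm.cons x ?_)
        refine (ih.append_left B.2).trans ?_
        rw [← List.append_assoc, ← List.append_assoc]
        exact List.perm_append_comm.append_right _
    · cases β with
      | nil => simp
      | cons x β =>
        have ih := ih (β := x :: β) (by simpa [numBlocks, ht] using h)
        rw [ins, if_neg ht, letters_cons, letters_cons, if_neg ht]
        simpa using ih

theorem letters_ins_ne {t' : Bool} (ht' : t' ≠ t) (β : List ℕ) (K : List Block) :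
    letters t' (ins t β K) = letters t' K := by
  induction K generalizing β with
  | nil => cases β <;> rfl
  | cons B K ih =>
    cases β with
    | nil => simp
    | cons x β =>
      rw [ins]
      split_ifs with ht
      · simp [ih, ht, Ne.symm ht']
      · simp [ih]

theorem length_ins (β : List ℕ) (K : List Block) : (ins t β K).length = K.length := by
  induction K generalizing β with
  | nil => cases β <;> rfl
  | cons B K ih =>
    cases β with
    | nil => simp
    | cons x β => rw [ins]; split_ifs <;> simp [ih]

theorem len_ins {β : List ℕ} {K : List Block} (h : β.length = numBlocks t K) {j : Bool → ℕ}
    (hK : ∀ B ∈ K, B.2.length = j B.1) :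
    ∀ B ∈ ins t β K, B.2.length = j B.1 + if B.1 = t then 1 else 0 := by
  induction K generalizing β with
  | nil => cases β <;> simp [ins]
  | cons B₀ K ih =>
    have ih := fun β hβ => ih (β := β) hβ fun B hB => hK B (List.mem_cons_of_mem _ hB)
    have h₀ := hK B₀ (by simp)
    by_cases ht : B₀.1 = t
    · cases β with
      | nil => simp [numBlocks, ht] at h
      | cons x β =>
        intro B hB
        rw [ins, if_pos ht] at hB
        rcases List.mem_cons.1 hB with rfl | hB
        · simp [ht, h₀]
        · exact ih β (by simpa [numBlocks, ht] using h) B hB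
    · intro B hB
      have h' : β.length = numBlocks t K := by simpa [numBlocks, ht] using h
      cases β with
      | nil =>
        rw [ins_nil_left] at hB
        rcases List.mem_cons.1 hB with rfl | hB
        · simp [ht, h₀]
        · exact ih [] h' B (by simpa using hB)
      | cons x β =>
        rw [ins, if_neg ht] at hB
        rcases List.mem_cons.1 hB with rfl | hB
        · simp [ht, h₀]
        · exact ih (x :: β) h' B hB

theorem first_ins {β : List ℕ} {K : List Block} (hβ : β.Nodup) (hβK : β.Disjoint (flat K))
    (hK : K.Pairwise fun B B' => B'.1 = true → B.2.Disjoint B'.2) :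
    (ins t β K).Pairwise fun B B' => B'.1 = true → B.2.Disjoint B'.2 := by
  induction K generalizing β with
  | nil => cases β <;> simp [ins]
  | cons B K ih =>
    cases β with
    | nil => simpa using hK
    | cons x β =>
      rw [List.pairwise_cons] at hK
      rw [List.nodup_cons] at hβ
      rw [flat_cons] at hβK
      have hxB : ∀ y ∈ x :: β, y ∉ B.2 := fun y hy h => hβK hy (List.mem_append_left _ h)
      have hxK : ∀ y ∈ x :: β, y ∉ flat K := fun y hy h => hβK hy (List.mem_append_right _ h)
      rw [ins]
      split_ifs with ht
      · refine List.pairwise_cons.2 ⟨fun B' hB' ht' y hy hy' => ?_,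
          ih hβ.2 (fun y hy => hxK y (List.mem_cons_of_mem _ hy)) hK.2⟩
        rcases List.mem_append.1 hy with hy | hy
        · rcases mem_ins hB' with hB' | ⟨B₀, hB₀, z, hz, -, rfl⟩
          · exact hK.1 B' hB' ht' hy hy'
          · rcases List.mem_append.1 hy' with hy' | hy'
            · exact hK.1 B₀ hB₀ ht' hy hy'
            · rw [List.mem_singleton.1 hy'] at hy
              exact hxB z (List.mem_cons_of_mem _ hz) hy
        · rw [List.mem_singleton.1 hy] at hy'
          rcases mem_flat_ins (mem_flat.2 ⟨B', hB', hy'⟩) with h | h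
          · exact hxK x (by simp) h
          · exact hβ.1 h
      · refine List.pairwise_cons.2 ⟨fun B' hB' ht' y hy hy' => ?_,
          ih (List.nodup_cons.2 hβ) (fun y hy => hxK y hy) hK.2⟩
        rcases mem_ins hB' with hB' | ⟨B₀, hB₀, z, hz, -, rfl⟩
        · exact hK.1 B' hB' ht' hy hy'
        · rcases List.mem_append.1 hy' with hy' | hy'
          · exact hK.1 B₀ hB₀ ht' hy hy'
          · rw [List.mem_singleton.1 hy'] at hy
            exact hxB z hz hy

/-- Inserting letters other than `a` and `b` does not matter to this pair. -/
theorem fits_ins {a b : ℕ} {p : List Bool} {β : List ℕ} {K : List Block} (ha : a ∉ β) (hb : b ∉ β)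
    (h : Fits (blk a b) p K) : Fits (blk a b) p (ins t β K) := by
  induction K generalizing β p with
  | nil => cases β <;> simpa [ins] using h
  | cons B K ih =>
    cases β with
    | nil => simpa using h
    | cons x β =>
      obtain ⟨p', hq, hp⟩ := h.of_cons (ok' := blk a b)
      simp only [List.mem_cons, not_or] at ha hb
      rw [ins]
      split_ifs with ht
      · refine hp _ _ (fun c hc => ?_) (ih ha.2 hb.2 hq)
        cases c <;> simp_all [blk]
      · exact hp _ _ (fun c hc => hc) (ih (by simp [ha]) (by simp [hb]) hq)

/-- The runs of two inserted letters. -/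
theorem fits_ins_append {a b : ℕ} {p : List Bool} {β rest : List ℕ} {K R : List Block}
    (ha : a ∉ flat K) (hb : b ∉ flat K) (hβ : Fits (ltr a b) p (β ++ rest))
    (hR : ∀ p', Fits (ltr a b) p' rest → Fits (blk a b) p' R) :
    Fits (blk a b) p (ins t β K ++ R) := by
  induction K generalizing β p with
  | nil =>
    have : ins t β [] = [] := by cases β <;> rfl
    rw [this, List.nil_append]
    exact hR p (hβ.sublist (List.sublist_append_right _ _))
  | cons B K ih =>
    rw [flat_cons, List.mem_append, not_or] at ha hb
    have hfree : ∀ c, blk a b c B := fun c => by cases c <;> simp [blk, ha, hb]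
    cases β with
    | nil =>
      rw [ins_nil_left]
      refine Fits.append (p := []) (fun B' hB' c => ?_) (hR p hβ)
      rcases List.mem_cons.1 hB' with rfl | hB'
      · exact hfree c
      · intro h
        have := mem_flat.2 ⟨B', hB', h⟩
        cases c
        exacts [ha.2 this, hb.2 this]
    | cons x β =>
      rw [ins]
      split_ifs with ht
      · rw [List.cons_append] at hβ ⊢
        obtain ⟨p', hp', hp⟩ := hβ.of_cons (ok' := blk a b)
        refine hp _ _ (fun c hc => ?_) (ih ha.2 hb.2 hp')
        cases c
        · simpa [blk, ha, ltr] using Ne.symm hc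
        · simpa [blk, hb, ltr] using Ne.symm hc
      · rw [List.cons_append]
        exact Fits.append (p := []) (l := [B]) (by simpa [Fits] using hfree) (ih ha.2 hb.2 hβ)

/-- Inserting letters other than `a` and `b`, and adding blocks without them on both sides. -/
theorem pairOK_ins {k a b : ℕ} {β : List ℕ} {K R₁ R₂ : List Block} (ha : a ∉ β) (hb : b ∉ β)
    (h₁ : Fits (blk a b) [] R₁) (h₂ : Fits (blk a b) [] R₂) (h : PairOK k K a b) :
    PairOK k (R₁ ++ ins t β K ++ R₂) a b := by
  have hpad : ∀ {p L}, Fits (blk a b) p L → Fits (blk a b) p (L ++ R₂) := fun h => by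
    simpa using h.append h₂
  -- A shared block survives with its tag: insertion only lengthens blocks, by letters other than
  -- `a` and `b`.
  have hsplit : ∀ (s : Bool) (γ : List ℕ) (L₁ L₂ : List Block), K = L₁ ++ (s, γ) :: L₂ →
      ∃ L₁' γ' L₂', ins t β K = L₁' ++ (s, γ') :: L₂' ∧ γ.Sublist γ' ∧
        (∀ p, Fits (blk a b) p L₁ → Fits (blk a b) p L₁') ∧
        (∀ p, Fits (blk a b) p L₂ → Fits (blk a b) p L₂') := by
    clear h
    intro s γ L₁ L₂ hK
    subst hK
    induction L₁ generalizing β with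
    | nil =>
      cases β with
      | nil => exact ⟨[], γ, L₂, by simp, .refl _, fun _ h => h, fun _ h => h⟩
      | cons x β =>
        simp only [List.mem_cons, not_or] at ha hb
        rw [List.nil_append, ins]
        split_ifs with hs
        · exact ⟨[], γ ++ [x], ins t β L₂, rfl, List.sublist_append_left _ _, fun _ h => h,
            fun _ h => fits_ins ha.2 hb.2 h⟩
        · exact ⟨[], γ, ins t (x :: β) L₂, rfl, .refl _, fun _ h => h,
            fun _ h => fits_ins (by simp [ha]) (by simp [hb]) h⟩
    | cons B L₁ ih =>
      cases β with
      | nil => exact ⟨B :: L₁, γ, L₂, by simp, .refl _, fun _ h => h, fun _ h => h⟩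
      | cons x β =>
        rw [List.cons_append, ins]
        split_ifs with hs
        · simp only [List.mem_cons, not_or] at ha hb
          obtain ⟨L₁', γ', L₂', h, hγ, hp₁, hp₂⟩ := ih (β := β) ha.2 hb.2
          refine ⟨(B.1, B.2 ++ [x]) :: L₁', γ', L₂', by rw [h]; rfl, hγ, fun p hp => ?_, hp₂⟩
          obtain ⟨p', hp', hp⟩ := hp.of_cons (ok' := blk a b)
          refine hp _ _ (fun c hc => ?_) (hp₁ _ hp')
          cases c <;> simp_all [blk]
        · obtain ⟨L₁', γ', L₂', h, hγ, hp₁, hp₂⟩ := ih (β := x :: β) ha hb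
          refine ⟨B :: L₁', γ', L₂', by rw [h]; rfl, hγ, fun p hp => ?_, hp₂⟩
          obtain ⟨p', hp', hp⟩ := hp.of_cons (ok' := blk a b)
          exact hp _ _ (fun c hc => hc) (hp₁ _ hp')
  rcases h with h | ⟨L₁, γ, L₂, hK, hγ, hL₁, hL₂⟩ | ⟨L₁, γ, L₂, hK, hγ, hL₁, hL₂⟩
  · left
    exact hpad (Fits.append h₁ (fits_ins ha hb h))
  · obtain ⟨L₁', γ', L₂', h, hγ', hp₁, hp₂⟩ := hsplit _ _ _ _ hK
    right; left
    exact ⟨R₁ ++ L₁', γ', L₂' ++ R₂, by simp [h], hγ.trans hγ', Fits.append h₁ (hp₁ _ hL₁),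
      hpad (hp₂ _ hL₂)⟩
  · obtain ⟨L₁', γ', L₂', h, hγ', hp₁, hp₂⟩ := hsplit _ _ _ _ hK
    right; right
    exact ⟨R₁ ++ L₁', γ', L₂' ++ R₂, by simp [h], hγ.trans hγ', Fits.append h₁ (hp₁ _ hL₁),
      hpad (hp₂ _ hL₂)⟩

end Ins

/-! ### Distribution over fresh copies -/

/-- Every block of `C`, with tag `t`, is distributed over a fresh copy of `bot t`. -/
def shuffle (bot : Bool → List Block) : ℕ → List Block → List Block
  | _, [] => []
  | k, B :: C => ins B.1 (B.2.map (Nat.pair 0)) (mapLetters (Nat.pair (k + 1)) (bot B.1)) ++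
      shuffle bot (k + 1) C

section Shuffle

variable {bot : Bool → List Block}

theorem pair_inj_right (k : ℕ) {x y : ℕ} (h : Nat.pair k x = Nat.pair k y) : x = y :=
  (Nat.pair_eq_pair.1 h).2

theorem pair_mem_map {k x : ℕ} {l : List ℕ} : Nat.pair k x ∈ l.map (Nat.pair k) ↔ x ∈ l := by
  constructor
  · intro h
    obtain ⟨y, hy, h⟩ := List.mem_map.1 h
    exact pair_inj_right k h ▸ hy
  · exact List.mem_map_of_mem

theorem pair_notMem_map {k k' x : ℕ} {l : List ℕ} (h : k ≠ k') :
    Nat.pair k x ∉ l.map (Nat.pair k') := by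
  intro h'
  obtain ⟨y, -, h'⟩ := List.mem_map.1 h'
  exact h (Nat.pair_eq_pair.1 h').1.symm

theorem disjoint_copy {k : ℕ} (β : List ℕ) (K : List Block) :
    (β.map (Nat.pair 0)).Disjoint (flat (mapLetters (Nat.pair (k + 1)) K)) := by
  intro x hx hx'
  obtain ⟨y, -, rfl⟩ := List.mem_map.1 hx
  rw [flat_mapLetters] at hx'
  exact pair_notMem_map (by omega) hx'

theorem shuffle_append (k : ℕ) (C₁ C₂ : List Block) :
    shuffle bot k (C₁ ++ C₂) = shuffle bot k C₁ ++ shuffle bot (k + C₁.length) C₂ := by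
  induction C₁ generalizing k with
  | nil => rfl
  | cons B C ih =>
    rw [List.cons_append, shuffle, shuffle, ih, List.append_assoc, List.length_cons,
      show k + 1 + C.length = k + (C.length + 1) by ring]

theorem mem_flat_shuffle {k x : ℕ} {C : List Block} (h : x ∈ flat (shuffle bot k C)) :
    (∃ a ∈ flat C, x = Nat.pair 0 a) ∨
      ∃ i s, k ≤ i ∧ i < k + C.length ∧ x = Nat.pair (i + 1) s := by
  induction C generalizing k with
  | nil => simp [shuffle] at h
  | cons B C ih =>
    rw [shuffle, flat_append, List.mem_append] at h
    rcases h with h | h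
    · rcases mem_flat_ins h with h | h
      · rw [flat_mapLetters] at h
        obtain ⟨s, -, rfl⟩ := List.mem_map.1 h
        exact Or.inr ⟨k, s, le_rfl, by simp, rfl⟩
      · obtain ⟨a, ha, rfl⟩ := List.mem_map.1 h
        exact Or.inl ⟨a, by simp [ha], rfl⟩
    · rcases ih h with ⟨a, ha, rfl⟩ | ⟨i, s, h₁, h₂, rfl⟩
      · exact Or.inl ⟨a, by simp [ha], rfl⟩
      · exact Or.inr ⟨i, s, by omega, by simp only [List.length_cons]; omega, rfl⟩

theorem pair_zero_mem_shuffle {k a : ℕ} {C : List Block}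
    (h : Nat.pair 0 a ∈ flat (shuffle bot k C)) : a ∈ flat C := by
  rcases mem_flat_shuffle h with ⟨a', ha, h⟩ | ⟨i, s, -, -, h⟩
  · exact pair_inj_right 0 h ▸ ha
  · have := (Nat.pair_eq_pair.1 h).1; omega

theorem pair_succ_mem_shuffle {k i s : ℕ} {C : List Block}
    (h : Nat.pair (i + 1) s ∈ flat (shuffle bot k C)) : k ≤ i ∧ i < k + C.length := by
  rcases mem_flat_shuffle h with ⟨a', ha, h⟩ | ⟨i', s', h₁, h₂, h⟩
  · have := (Nat.pair_eq_pair.1 h).1; omega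
  · have := (Nat.pair_eq_pair.1 h).1; omega

theorem length_shuffle_le {x : ℕ} (hx : ∀ t, (bot t).length ≤ x) (k : ℕ) (C : List Block) :
    (shuffle bot k C).length ≤ C.length * x := by
  induction C generalizing k with
  | nil => simp [shuffle]
  | cons B C ih =>
    rw [shuffle, List.length_append, length_ins, List.length_cons, Nat.add_mul, mapLetters,
      List.length_map]
    have := ih (k + 1)
    have := hx B.1
    omega

variable {v : ℕ} {w J : Bool → ℕ} {j : Bool → Bool → ℕ} {C : List Block}

theorem frame_copy (hbot : ∀ t, Frame v (j t) (bot t)) (k : ℕ) (t : Bool) :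
    Frame v (j t) (mapLetters (Nat.pair (k + 1)) (bot t)) :=
  (hbot t).mapLetters fun _ _ _ _ h => pair_inj_right _ h

theorem len_copy (hC : ∀ B ∈ C, B.2.length = numBlocks B.1 (bot B.1)) (k : ℕ) {B : Block}
    (hB : B ∈ C) : (B.2.map (Nat.pair 0)).length =
      numBlocks B.1 (mapLetters (Nat.pair (k + 1)) (bot B.1)) := by
  rw [List.length_map, numBlocks_mapLetters, hC B hB]

theorem mem_letters_shuffle (hC : ∀ B ∈ C, B.2.length = numBlocks B.1 (bot B.1)) {k a : ℕ}
    {t : Bool} (ha : a ∈ letters t C) : Nat.pair 0 a ∈ letters t (shuffle bot k C) := by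
  induction C generalizing k with
  | nil => simp at ha
  | cons B C ih =>
    rw [letters_cons, List.mem_append] at ha
    rw [shuffle, letters_append, List.mem_append]
    rcases ha with ha | ha
    · left
      split_ifs at ha with ht
      · subst ht
        rw [(letters_ins_self (len_copy hC k (by simp))).mem_iff]
        exact List.mem_append_left _ (List.mem_map_of_mem ha)
      · simp at ha
    · exact Or.inr (ih (fun B hB => hC B (List.mem_cons_of_mem _ hB)) ha)

theorem letters_true_of_mem_shuffle (hC : ∀ B ∈ C, B.2.length = numBlocks B.1 (bot B.1))
    (hbot : ∀ t, Frame v (j t) (bot t)) {k i s : ℕ}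
    (h : Nat.pair (i + 1) s ∈ flat (shuffle bot k C)) :
    Nat.pair (i + 1) s ∈ letters true (shuffle bot k C) := by
  induction C generalizing k with
  | nil => simp [shuffle] at h
  | cons B C ih =>
    rw [shuffle, flat_append, List.mem_append] at h
    rw [shuffle, letters_append, List.mem_append]
    rcases h with h | h
    · left
      rcases mem_flat_ins h with h | h
      · have h' := (frame_copy hbot k B.1).cover _ h
        by_cases ht : true = B.1
        · rw [ht] at h' ⊢
          rw [(letters_ins_self (len_copy hC k (by simp))).mem_iff]
          exact List.mem_append_right _ h'
        · rwa [letters_ins_ne ht]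
      · exact absurd h (pair_notMem_map (by omega))
    · exact Or.inr (ih (fun B hB => hC B (List.mem_cons_of_mem _ hB)) h)

/-- `X` counts the letters of the copies. They have multiplicity `v` themselves, so a list `C` of
multiplicity `v` keeps it. -/
theorem count_shuffle (hC : ∀ B ∈ C, B.2.length = numBlocks B.1 (bot B.1))
    (hbot : ∀ t, Frame v (j t) (bot t)) (k : ℕ) :
    ∃ X, (letters true (shuffle bot k C)).length = (letters true C).length + X ∧
      (letters false (shuffle bot k C)).length = (letters false C).length + v * X := by
  induction C generalizing k with
  | nil => exact ⟨0, by simp [shuffle], by simp [shuffle]⟩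
  | cons B C ih =>
    obtain ⟨X, hX₁, hX₂⟩ := ih (fun B hB => hC B (List.mem_cons_of_mem _ hB)) (k + 1)
    have hcount := (hbot B.1).count
    have hself := (letters_ins_self (len_copy hC k (by simp : B ∈ B :: C))).length_eq
    have hne := fun t ht => congrArg List.length (letters_ins_ne (t := B.1) (t' := t) ht
      (B.2.map (Nat.pair 0)) (mapLetters (Nat.pair (k + 1)) (bot B.1)))
    simp only [letters_mapLetters, List.length_append, List.length_map] at hself hne
    refine ⟨(letters true (bot B.1)).length + X, ?_, ?_⟩
    all_goals
      rw [shuffle, letters_append, List.length_append, letters_cons, List.length_append]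
      rcases B with ⟨_ | _, β⟩
    · simp only [Bool.false_eq_true, if_false, List.length_nil]
      rw [hne true (by simp), hX₁]; ring
    · simp only [if_true]
      rw [hself, hX₁]; ring
    · simp only [if_true]
      rw [hself, hX₂, hcount]; ring
    · simp only [Bool.true_eq_false, if_false, List.length_nil]
      rw [hne false (by simp), hX₂, hcount]; ring

/-- Distribution preserves tags: `key` says that an inserted letter in a block of some tag comes
from a block of `C` with the same tag. Letters of the copies are fresh. -/
theorem first_shuffle (hn : ∀ B ∈ C, B.2.Nodup)
    (hf : C.Pairwise fun B B' => B'.1 = true → B.2.Disjoint B'.2)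
    (hbot : ∀ t, Frame v (j t) (bot t)) (k : ℕ) :
    (shuffle bot k C).Pairwise fun B B' => B'.1 = true → B.2.Disjoint B'.2 := by
  have key : ∀ (C : List Block) (k : ℕ) (B : Block), B ∈ shuffle bot k C → ∀ a,
      Nat.pair 0 a ∈ B.2 → ∃ B' ∈ C, B'.1 = B.1 ∧ a ∈ B'.2 := by
    intro C
    induction C with
    | nil => simp [shuffle]
    | cons B₀ C ih =>
      intro k B hB a ha
      rw [shuffle, List.mem_append] at hB
      rcases hB with hB | hB
      · have hK : ∀ B ∈ mapLetters (Nat.pair (k + 1)) (bot B₀.1), Nat.pair 0 a ∉ B.2 :=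
          fun B hB h => disjoint_copy [a] _ (by simp) (mem_flat.2 ⟨B, hB, h⟩)
        rcases mem_ins hB with hB | ⟨B₁, hB₁, x, hx, ht, rfl⟩
        · exact absurd ha (hK B hB)
        · rcases List.mem_append.1 ha with ha | ha
          · exact absurd ha (hK B₁ hB₁)
          · rw [← List.mem_singleton.1 ha, pair_mem_map] at hx
            exact ⟨B₀, by simp, ht.symm, hx⟩
      · obtain ⟨B', hB', h⟩ := ih (k + 1) B hB a ha
        exact ⟨B', List.mem_cons_of_mem _ hB', h⟩
  induction C generalizing k with
  | nil => simp [shuffle]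
  | cons B C ih =>
    rw [List.pairwise_cons] at hf
    rw [shuffle, List.pairwise_append]
    refine ⟨first_ins ((hn B (by simp)).map_on fun x _ y _ h => pair_inj_right 0 h)
      (disjoint_copy _ _) (frame_copy hbot k B.1).first,
      ih (fun B hB => hn B (List.mem_cons_of_mem _ hB)) hf.2 (k + 1), ?_⟩
    intro B₁ h₁ B₂ h₂ ht x hx₁ hx₂
    have hx₁ := mem_flat_ins (mem_flat.2 ⟨B₁, h₁, hx₁⟩)
    rcases mem_flat_shuffle (mem_flat.2 ⟨B₂, h₂, hx₂⟩) with ⟨a, ha, rfl⟩ | ⟨i, s, hi, -, rfl⟩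
    · rcases hx₁ with hx₁ | hx₁
      · exact disjoint_copy [a] _ (by simp) hx₁
      · obtain ⟨B', hB', ht', ha'⟩ := key C (k + 1) B₂ h₂ a hx₂
        exact hf.1 B' hB' (ht'.trans ht) (pair_mem_map.1 hx₁) ha'
    · rcases hx₁ with hx₁ | hx₁
      · rw [flat_mapLetters] at hx₁
        exact pair_notMem_map (by omega) hx₁
      · exact pair_notMem_map (by omega) hx₁

theorem frame_shuffle (hC : Frame v w C) (hw : ∀ t, w t = numBlocks t (bot t))
    (hbot : ∀ t, Frame v (j t) (bot t))
    (hJ : ∀ t t', J t' = j t t' + if t' = t then 1 else 0) (k : ℕ) :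
    Frame v J (shuffle bot k C) := by
  have hlen : ∀ B ∈ C, B.2.length = numBlocks B.1 (bot B.1) := fun B hB => by
    rw [hC.len B hB, hw]
  refine ⟨?_, ?_, first_shuffle hC.nodup hC.first hbot k, ?_, ?_⟩
  · have hn := hC.nodup
    clear hC hlen
    induction C generalizing k with
    | nil => simp [shuffle]
    | cons B C ih =>
      intro B' hB'
      rw [shuffle, List.mem_append] at hB'
      rcases hB' with hB' | hB'
      · have hcopy := (frame_copy hbot k B.1).nodup
        rcases mem_ins hB' with hB' | ⟨B₁, hB₁, x, hx, -, rfl⟩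
        · exact hcopy B' hB'
        · refine List.Nodup.append (hcopy B₁ hB₁) (by simp) fun y hy hy' => ?_
          rw [List.mem_singleton.1 hy'] at hy
          exact disjoint_copy _ _ hx (mem_flat.2 ⟨B₁, hB₁, hy⟩)
      · exact ih (k + 1) (fun B hB => hn B (List.mem_cons_of_mem _ hB)) B' hB'
  · clear hC
    induction C generalizing k with
    | nil => simp [shuffle]
    | cons B C ih =>
      intro B' hB'
      rw [shuffle, List.mem_append] at hB'
      rcases hB' with hB' | hB'
      · rw [hJ B.1]
        exact len_ins (len_copy hlen k (by simp)) (frame_copy hbot k B.1).len B' hB'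
      · exact ih (k + 1) (fun B hB => hlen B (List.mem_cons_of_mem _ hB)) B' hB'
  · intro x hx
    rcases mem_flat_shuffle hx with ⟨a, ha, rfl⟩ | ⟨i, s, -, -, rfl⟩
    · exact mem_letters_shuffle hlen (hC.cover a ha)
    · exact letters_true_of_mem_shuffle hlen hbot hx
  · obtain ⟨X, h₁, h₂⟩ := count_shuffle hlen hbot k
    rw [h₁, h₂, hC.count]; ring

theorem blk_of_notMem_right {a b : ℕ} {L : List Block} (h : b ∉ flat L) :
    Fits (blk a b) [true] L :=
  Fits.of_forall fun B hB hb => h (mem_flat.2 ⟨B, hB, hb⟩)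

theorem blk_of_notMem_left {a b : ℕ} {L : List Block} (h : a ∉ flat L) :
    Fits (blk a b) [false] L :=
  Fits.of_forall fun B hB hb => h (mem_flat.2 ⟨B, hB, hb⟩)

theorem blk_of_notMem {a b : ℕ} {L : List Block} (ha : a ∉ flat L) (hb : b ∉ flat L) :
    Fits (blk a b) [] L := by
  intro B hB c h
  have := mem_flat.2 ⟨B, hB, h⟩
  cases c
  exacts [ha this, hb this]

theorem pairOK_of_fits {K k a b : ℕ} {L : List Block} (h : Fits (blk a b) (alt true k) L)
    (hk : k ≤ K) : PairOK K L a b := Or.inl (h.alt_le hk)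

theorem pairOK_mapLetters {K a b : ℕ} {L : List Block} {f : ℕ → ℕ} (hf : f.Injective)
    (h : PairOK K L a b) : PairOK K (mapLetters f L) (f a) (f b) := by
  have key : ∀ {p L}, Fits (blk a b) p L → Fits (blk (f a) (f b)) p (mapLetters f L) := by
    intro p L h
    refine h.map _ fun B _ c hc hcB => hc ?_
    obtain ⟨x, hx, h⟩ := List.mem_map.1 hcB
    cases c
    · exact hf h ▸ hx
    · exact hf h ▸ hx
  rcases h with h | ⟨L₁, β, L₂, rfl, hβ, h₁, h₂⟩ | ⟨L₁, β, L₂, rfl, hβ, h₁, h₂⟩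
  · exact Or.inl (key h)
  · exact Or.inr (Or.inl ⟨mapLetters f L₁, β.map f, mapLetters f L₂, by simp [mapLetters],
      by simpa using hβ.map f, key h₁, key h₂⟩)
  · exact Or.inr (Or.inr ⟨mapLetters f L₁, β.map f, mapLetters f L₂, by simp [mapLetters],
      by simpa using hβ.map f, key h₁, key h₂⟩)

/-- Two letters of the distributed list. -/
theorem fits_shuffle {a b k : ℕ} {p : List Bool} (h : Fits (ltr a b) p (flat C)) :
    Fits (blk (Nat.pair 0 a) (Nat.pair 0 b)) p (shuffle bot k C) := by
  have h : Fits (ltr (Nat.pair 0 a) (Nat.pair 0 b)) p ((flat C).map (Nat.pair 0)) :=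
    h.map _ fun x _ c hc hxc => hc (by cases c <;> exact pair_inj_right 0 hxc)
  induction C generalizing k p with
  | nil => exact Fits.nil_right p
  | cons B C ih =>
    rw [flat_cons, List.map_append] at h
    refine fits_ins_append ?_ ?_ h fun p' hp' => ?_
    · exact disjoint_copy [a] _ (by simp)
    · exact disjoint_copy [b] _ (by simp)
    · refine ih ?_ hp'
      -- The renaming is undone, since the induction hypothesis speaks of the letters of `C`
      -- themselves.
      have := hp'.map (ok' := ltr a b) (fun x => (Nat.unpair x).2) fun x hx c hc hxc => hc ?_
      · simpa [Function.comp_def] using this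
      · obtain ⟨y, -, rfl⟩ := List.mem_map.1 hx
        cases c <;> simpa using hxc

/-- A letter of the distributed list and a letter of one of the copies. -/
theorem pairOK_shuffle_mixed {K : ℕ} (hK : 5 ≤ K) (hC : Frame v w C)
    (hw : ∀ t, w t = numBlocks t (bot t)) (hbot : ∀ t, Frame v (j t) (bot t)) (a i s : ℕ) :
    PairOK K (shuffle bot 0 C) (Nat.pair 0 a) (Nat.pair (i + 1) s) := by
  by_cases hi : i < C.length
  swap
  · refine pairOK_of_fits (k := 1) (blk_of_notMem_right fun h => ?_) (by omega)
    have := pair_succ_mem_shuffle h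
    omega
  obtain ⟨C₁, B, C₂, hCC, hC₁⟩ : ∃ C₁ B C₂, C = C₁ ++ B :: C₂ ∧ C₁.length = i :=
    ⟨C.take i, C[i], C.drop (i + 1), by simp, by simp; omega⟩
  subst hCC
  have hB : B ∈ C₁ ++ B :: C₂ := by simp
  rw [shuffle_append, shuffle, Nat.zero_add, hC₁]
  set R₁ := shuffle bot 0 C₁ with hR₁
  set R₂ := shuffle bot (i + 1) C₂ with hR₂
  set x := Nat.pair 0 a with hx
  set y := Nat.pair (i + 1) s with hy
  have hy₁ : y ∉ flat R₁ := fun h => by have := pair_succ_mem_shuffle h; omega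
  have hy₂ : y ∉ flat R₂ := fun h => by have := pair_succ_mem_shuffle h; omega
  have hyβ : ∀ β : List ℕ, y ∉ β.map (Nat.pair 0) := fun β => pair_notMem_map (by omega)
  have hcopy := frame_copy hbot i B.1
  have hlen := len_copy (fun B hB => by rw [hC.len B hB, hw]) i hB
  have hxK : x ∉ flat (mapLetters (Nat.pair (i + 1)) (bot B.1)) :=
    disjoint_copy [a] _ (by simp [hx])
  generalize mapLetters (Nat.pair (i + 1)) (bot B.1) = K' at hcopy hlen hxK ⊢
  by_cases ha : a ∈ B.2
  swap
  · have hxI : x ∉ flat (ins B.1 (B.2.map (Nat.pair 0)) K') := fun h => by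
      rcases mem_flat_ins h with h | h
      · exact hxK h
      · exact ha (pair_mem_map.1 h)
    -- Here `y` lives in one copy, and `x` only before and after it: runs `x y x`.
    exact pairOK_of_fits (k := 3) ((blk_of_notMem_right hy₁).append
      ((blk_of_notMem_left hxI).append (blk_of_notMem_right hy₂))) (by omega)
  obtain ⟨β₁, β₂, hβ⟩ := List.append_of_mem ha
  have hnd := hC.nodup B hB
  rw [hβ] at hnd
  have ha₁ : a ∉ β₁ := fun h => List.disjoint_of_nodup_append hnd h (by simp)
  have ha₂ : a ∉ β₂ := (List.nodup_cons.1 (List.nodup_append.1 hnd).2.1).1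
  rw [hβ, List.map_append, List.map_cons] at hlen ⊢
  obtain ⟨K₁, γ, K₂, hK', hins⟩ := ins_split hlen
  rw [hins]
  rw [hK', flat_append, flat_cons, List.mem_append, List.mem_append, not_or, not_or] at hxK
  obtain ⟨hxK₁, hxγ, hxK₂⟩ := hxK
  set I₁ := ins B.1 (β₁.map (Nat.pair 0)) K₁
  set I₂ := ins B.1 (β₂.map (Nat.pair 0)) K₂
  have hxI₁ : x ∉ flat I₁ := fun h => by
    rcases mem_flat_ins h with h | h
    exacts [hxK₁ h, ha₁ (pair_mem_map.1 h)]
  have hxI₂ : x ∉ flat I₂ := fun h => by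
    rcases mem_flat_ins h with h | h
    exacts [hxK₂ h, ha₂ (pair_mem_map.1 h)]
  have hassoc : R₁ ++ (I₁ ++ (B.1, γ ++ [Nat.pair 0 a]) :: I₂ ++ R₂) =
      (R₁ ++ I₁) ++ (B.1, γ ++ [x]) :: (I₂ ++ R₂) := by simp [hx]
  rw [hassoc]
  have hright : Fits (blk x y) [false, true] (I₂ ++ R₂) :=
    (blk_of_notMem_left hxI₂).append (blk_of_notMem_right hy₂)
  have hleft : Fits (blk x y) [true, false] (R₁ ++ I₁) :=
    (blk_of_notMem_right hy₁).append (blk_of_notMem_left hxI₁)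
  by_cases hyγ : y ∈ γ
  swap
  -- The block that receives `x` is free of `y`, so `x` adds a single run inside the copy: `x y x y
  -- x`.
  · refine pairOK_of_fits (k := 5) (hleft.append (p := [true, false])
      (q := [true, false, true]) (Fits.append (p := [true]) (l := [(B.1, γ ++ [x])])
        (Fits.of_forall fun B' hB' h => ?_) hright)) hK
    rw [List.mem_singleton.1 hB'] at h
    rcases List.mem_append.1 h with h | h
    · exact hyγ h
    · rw [List.mem_singleton] at h
      have := (Nat.pair_eq_pair.1 h).1
      omega
  -- The inserted letter stands last in the shared block; this fixes the order that `PairOK`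
  -- demands.
  have hsub : [y, x].Sublist (γ ++ [x]) :=
    (List.singleton_sublist.2 hyγ).append (List.Sublist.refl [x])
  cases hBt : B.1
  · exact Or.inr (Or.inr ⟨_, _, _, rfl, hsub, hleft, hright⟩)
  · refine Or.inr (Or.inl ⟨_, _, _, rfl, hsub, ?_, hright⟩)
    -- A shared block tagged `true` holds the first occurrence of both letters: of `x` by the frame
    -- `C`, of `y` by the frame of the copy.
    refine Fits.append (p := []) (blk_of_notMem (fun h => ?_) hy₁) (blk_of_notMem hxI₁ fun h => ?_)
    · obtain ⟨B', hB', haB'⟩ := mem_flat.1 (pair_zero_mem_shuffle h)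
      exact (List.pairwise_append.1 hC.first).2.2 B' hB' B (by simp) hBt haB' ha
    · rcases mem_flat_ins h with h | h
      · obtain ⟨B', hB', hyB'⟩ := mem_flat.1 h
        have hfirst := hcopy.first
        rw [hK'] at hfirst
        exact (List.pairwise_append.1 hfirst).2.2 B' hB' (B.1, γ) (by simp) hBt hyB' hyγ
      · exact hyβ _ h

/-- The cases are the origins of the letters. Two letters of `C` are put into different blocks and
keep their runs from `flat C`; two letters of one copy keep their relation from `bot`; letters of
different copies form two runs; mixed pairs are the only new source of shared blocks. -/
theorem pairOK_shuffle {K : ℕ} (hK : 5 ≤ K) (hC : Frame v w C)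
    (hw : ∀ t, w t = numBlocks t (bot t)) (hbot : ∀ t, Frame v (j t) (bot t))
    (hpC : ∀ a b, a ≠ b → Fits (ltr a b) (alt true K) (flat C) ∨
      Fits (ltr b a) (alt true K) (flat C))
    (hpbot : ∀ t a b, a ≠ b → PairOK K (bot t) a b ∨ PairOK K (bot t) b a) {x y : ℕ}
    (hxy : x ≠ y) : PairOK K (shuffle bot 0 C) x y ∨ PairOK K (shuffle bot 0 C) y x := by
  obtain ⟨i, a, rfl⟩ : ∃ i a, x = Nat.pair i a := ⟨_, _, (Nat.pair_unpair x).symm⟩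
  obtain ⟨k, b, rfl⟩ : ∃ k b, y = Nat.pair k b := ⟨_, _, (Nat.pair_unpair y).symm⟩
  have hlt : ∀ i a k b, i < k → PairOK K (shuffle bot 0 C) (Nat.pair (i + 1) a)
      (Nat.pair (k + 1) b) := by
    intro i a k b hik
    have hsplit := shuffle_append (bot := bot) 0 (C.take k) (C.drop k)
    rw [List.take_append_drop] at hsplit
    rw [hsplit]
    refine pairOK_of_fits (k := 2) ((blk_of_notMem_right fun h => ?_).append
      (blk_of_notMem_left fun h => ?_)) (by omega)
    · have := (pair_succ_mem_shuffle h).2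
      simp at this
    · have h := pair_succ_mem_shuffle h
      simp at h
      omega
  rcases i with _ | i <;> rcases k with _ | k
  · have hab : a ≠ b := fun h => hxy (by rw [h])
    exact (hpC a b hab).imp (fun h => Or.inl (fits_shuffle h)) fun h => Or.inl (fits_shuffle h)
  · exact Or.inl (pairOK_shuffle_mixed hK hC hw hbot a k b)
  · exact Or.inr (pairOK_shuffle_mixed hK hC hw hbot b i a)
  · rcases lt_trichotomy i k with h | rfl | h
    · exact Or.inl (hlt i a k b h)
    · have hab : a ≠ b := fun h => hxy (by rw [h])
      by_cases hi : i < C.length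
      swap
      · refine Or.inl (pairOK_of_fits (k := 1) (blk_of_notMem_right fun h => ?_) (by omega))
        have := pair_succ_mem_shuffle h
        omega
      obtain ⟨C₁, B, C₂, hCC, hC₁⟩ : ∃ C₁ B C₂, C = C₁ ++ B :: C₂ ∧ C₁.length = i :=
        ⟨C.take i, C[i], C.drop (i + 1), by simp, by simp; omega⟩
      have key : ∀ a b, PairOK K (bot B.1) a b →
          PairOK K (shuffle bot 0 C) (Nat.pair (i + 1) a) (Nat.pair (i + 1) b) := by
        intro a b h
        rw [hCC, shuffle_append, shuffle, Nat.zero_add, hC₁, ← List.append_assoc]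
        have h₁ : ∀ s, Nat.pair (i + 1) s ∉ flat (shuffle bot 0 C₁) := fun s h => by
          have := pair_succ_mem_shuffle h; omega
        have h₂ : ∀ s, Nat.pair (i + 1) s ∉ flat (shuffle bot (i + 1) C₂) := fun s h => by
          have := pair_succ_mem_shuffle h; omega
        exact pairOK_ins (pair_notMem_map (by omega)) (pair_notMem_map (by omega))
          (blk_of_notMem (h₁ a) (h₁ b)) (blk_of_notMem (h₂ a) (h₂ b))
          (pairOK_mapLetters (fun x y h => pair_inj_right _ h) h)
      exact (hpbot B.1 a b hab).imp (key a b) (key b a)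
    · exact Or.inr (hlt k b i a h)

end Shuffle

/-! ### Good frames and the order of first occurrences -/

/-- A function on tags with given values. -/
def dims (a b : ℕ) (t : Bool) : ℕ := bif t then a else b

/-- A frame in which any two letters form at most `K` runs. -/
structure Good (K v : ℕ) (j : Bool → ℕ) (L : List Block) : Prop extends Frame v j L where
  pair : ∀ a b, a ≠ b → PairOK K L a b ∨ PairOK K L b a

/-- Even before expansion, a shared `true` block leaves the runs `baba`, and a shared `false` block
`ab|ba|ba`, that is `ababa`. -/
theorem PairOK.fits_flat {K a b : ℕ} {L : List Block} (hK : 5 ≤ K) (hn : ∀ B ∈ L, B.2.Nodup)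
    (h : PairOK K L a b) :
    Fits (ltr a b) (alt true K) (flat L) ∨ Fits (ltr b a) (alt true K) (flat L) := by
  rcases h with h | ⟨L₁, β, L₂, rfl, hβ, h₁, h₂⟩ | ⟨L₁, β, L₂, rfl, hβ, h₁, h₂⟩
  · exact Or.inl h.flat
  · right
    have h₃ := fits_of_nodup (hn (true, β) (by simp)) hβ
    have h := (h₁.blk_swap.flat.append h₃).append h₂.blk_swap.flat
    refine Fits.alt_le (k := 4) ?_ (by omega)
    simpa [alt] using h
  · left
    have h₃ := (fits_of_nodup (hn (false, β) (by simp)) hβ).ltr_swap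
    have h := (h₁.flat.append h₃).append h₂.flat
    have h := Fits.collapse (q := [true]) h
    refine Fits.alt_le (k := 5) ?_ hK
    simpa [alt] using h

theorem Good.fits_flat {K v : ℕ} {j : Bool → ℕ} {L : List Block} (hK : 5 ≤ K) (h : Good K v j L)
    {a b : ℕ} (hab : a ≠ b) :
    Fits (ltr a b) (alt true K) (flat L) ∨ Fits (ltr b a) (alt true K) (flat L) := by
  rcases h.pair a b hab with h' | h'
  · exact h'.fits_flat hK h.nodup
  · exact (h'.fits_flat hK h.nodup).symm

/-- The runs of two letters start with the letter whose first occurrence comes first. -/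
theorem Good.fits_of_order {K v : ℕ} {j : Bool → ℕ} {L : List Block} (hK : 5 ≤ K)
    (h : Good K v j L) {a b : ℕ} (hab : [a, b].Sublist (letters true L)) :
    Fits (ltr a b) (alt true K) (flat L) := by
  have hne : a ≠ b := by simpa using h.nodup_letters.sublist hab
  rcases h.fits_flat hK hne with h' | h'
  · exact h'
  have h' := h'.ltr_swap
  rw [alt_map_not] at h'
  obtain ⟨K, rfl⟩ : ∃ K', K = K' + 1 := ⟨K - 1, by omega⟩
  obtain ⟨⟨t, β⟩, hA, rfl, ha⟩ := mem_letters.1 (hab.subset (by simp : a ∈ [a, b]))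
  obtain ⟨L₁, L₂, rfl⟩ := List.append_of_mem hA
  obtain ⟨β₁, β₂, rfl⟩ := List.append_of_mem ha
  have hfirst := List.pairwise_append.1 h.first
  have hfirst' := (List.pairwise_cons.1 hfirst.2.1).1
  have ha₁ : a ∉ flat L₁ := fun h' => by
    obtain ⟨B, hB, haB⟩ := mem_flat.1 h'
    exact hfirst.2.2 B hB _ (by simp) rfl haB ha
  have hnd := h.nodup (true, β₁ ++ a :: β₂) (by simp)
  have haβ : a ∉ β₁ := fun h' => List.disjoint_of_nodup_append hnd h' (by simp)
  have hl := h.nodup_letters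
  have hb : b ∉ letters true L₁ ++ β₁ := by
    intro hb
    have hsplit : letters true (L₁ ++ (true, β₁ ++ a :: β₂) :: L₂) =
        (letters true L₁ ++ β₁) ++ a :: (β₂ ++ letters true L₂) := by simp
    rw [hsplit] at hab hl
    have ha' : a ∉ letters true L₁ ++ β₁ := fun h' =>
      List.disjoint_of_nodup_append hl h' (by simp)
    obtain ⟨s, t, hst, hs, ht⟩ := List.sublist_append_iff.1 hab
    cases s with
    | nil =>
      have : b ∈ t := by rw [List.nil_append] at hst; simp [← hst]
      exact List.disjoint_of_nodup_append hl hb (ht.subset this)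
    | cons z s =>
      rw [List.cons_append, List.cons.injEq] at hst
      exact ha' (hs.subset (by simp [hst.1]))
  rw [List.mem_append, not_or] at hb
  have hb₁ : b ∉ flat L₁ := fun h' => by
    obtain ⟨B, hB, hbB⟩ := mem_flat.1 h'
    obtain ⟨B', hB', ht, hbB'⟩ := mem_letters.1 (h.cover b (mem_flat.2
      ⟨B, List.mem_append_left _ hB, hbB⟩))
    rcases List.mem_append.1 hB' with hB' | hB'
    · exact hb.1 (mem_letters.2 ⟨B', hB', ht, hbB'⟩)
    · exact hfirst.2.2 B hB B' hB' ht hbB hbB'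
  have hflat : flat (L₁ ++ (true, β₁ ++ a :: β₂) :: L₂) =
      (flat L₁ ++ β₁) ++ a :: (β₂ ++ flat L₂) := by simp
  rw [hflat] at h' ⊢
  -- Beyond the prefix free of both letters stands an `a`, so the opening run of `b` is empty and
  -- can be dropped.
  have h' := (h'.sublist (List.sublist_append_right _ _)).drop_head (by simp [ltr])
  refine Fits.alt_le (k := K) (Fits.append (p := []) ?_ h') (by omega)
  intro x hx c hxc
  rcases List.mem_append.1 hx with hx | hx <;> cases c <;> simp only [cond_true, cond_false] at hxc
  · exact ha₁ (hxc ▸ hx)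
  · exact hb₁ (hxc ▸ hx)
  · exact haβ (hxc ▸ hx)
  · exact hb.2 (hxc ▸ hx)

/-! ### The mirrored middle list -/

/-- The first `k` consecutive pieces of length `w` of a list. -/
def chunks (w : ℕ) : ℕ → List ℕ → List (List ℕ)
  | 0, _ => []
  | k + 1, l => l.take w :: chunks w k (l.drop w)

section Chunks

variable {w k : ℕ} {l : List ℕ}

theorem length_chunks : (chunks w k l).length = k := by
  induction k generalizing l with
  | zero => rfl
  | succ k ih => simp [chunks, ih]

theorem flatten_chunks (h : l.length = k * w) : (chunks w k l).flatten = l := by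
  induction k generalizing l with
  | zero =>
    have : l = [] := by simpa using h
    subst this; rfl
  | succ k ih =>
    rw [Nat.add_mul, Nat.one_mul] at h
    rw [chunks, List.flatten_cons, ih (by rw [List.length_drop]; omega), List.take_append_drop]

theorem length_of_mem_chunks (h : l.length = k * w) : ∀ β ∈ chunks w k l, β.length = w := by
  induction k generalizing l with
  | zero => simp [chunks]
  | succ k ih =>
    rw [Nat.add_mul, Nat.one_mul] at h
    intro β hβ
    rcases List.mem_cons.1 hβ with rfl | hβ
    · rw [List.length_take]; omega
    · exact ih (by rw [List.length_drop]; omega) β hβ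

theorem flat_tag (t : Bool) (L : List (List ℕ)) : flat (L.map (Prod.mk t)) = L.flatten := by
  induction L with
  | nil => rfl
  | cons β L ih => simp [ih]

theorem letters_tag (t t' : Bool) (L : List (List ℕ)) :
    letters t (L.map (Prod.mk t')) = if t' = t then L.flatten else [] := by
  induction L with
  | nil => simp
  | cons β L ih =>
    rw [List.map_cons, letters_cons, ih]
    split_ifs <;> simp

end Chunks

/-- The letters `0, …, ab - 1` in blocks of length `a`, and then in reverse order in blocks of
length `b`. -/
def mirror (a b : ℕ) : List Block :=
  (chunks a b (List.range (a * b))).map (Prod.mk true) ++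
    (chunks b a (List.range (a * b)).reverse).map (Prod.mk false)

section Mirror

variable (a b : ℕ)

theorem length_mirror : (mirror a b).length = b + a := by
  simp [mirror, length_chunks]

theorem flat_mirror : flat (mirror a b) = List.range (a * b) ++ (List.range (a * b)).reverse := by
  rw [mirror, flat_append, flat_tag, flat_tag, flatten_chunks (by simp [mul_comm]),
    flatten_chunks (by simp)]

theorem letters_true_mirror : letters true (mirror a b) = List.range (a * b) := by
  rw [mirror, letters_append, letters_tag, letters_tag, flatten_chunks (by simp [mul_comm])]
  simp

theorem letters_false_mirror : letters false (mirror a b) = (List.range (a * b)).reverse := by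
  rw [mirror, letters_append, letters_tag, letters_tag,
    flatten_chunks (w := b) (k := a) (by simp)]
  simp

theorem frame_mirror : Frame 1 (dims a b) (mirror a b) := by
  have h₁ : (List.range (a * b)).length = b * a := by simp [mul_comm]
  have h₂ : (List.range (a * b)).reverse.length = a * b := by simp
  have hn₁ : (chunks a b (List.range (a * b))).flatten.Nodup := by
    rw [flatten_chunks h₁]; exact List.nodup_range
  have hn₂ : (chunks b a (List.range (a * b)).reverse).flatten.Nodup := by
    rw [flatten_chunks h₂]; exact List.nodup_reverse.2 List.nodup_range
  rw [List.nodup_flatten] at hn₁ hn₂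
  refine ⟨fun B hB => ?_, fun B hB => ?_, ?_, fun x hx => ?_, ?_⟩
  · rcases List.mem_append.1 hB with hB | hB <;> obtain ⟨β, hβ, rfl⟩ := List.mem_map.1 hB
    exacts [hn₁.1 β hβ, hn₂.1 β hβ]
  · rcases List.mem_append.1 hB with hB | hB <;> obtain ⟨β, hβ, rfl⟩ := List.mem_map.1 hB
    exacts [length_of_mem_chunks h₁ β hβ, length_of_mem_chunks h₂ β hβ]
  · rw [mirror, List.pairwise_append, List.pairwise_map, List.pairwise_map]
    refine ⟨hn₁.2.imp (by simp), List.pairwise_of_forall (by simp), fun B hB B' hB' ht => ?_⟩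
    obtain ⟨β, hβ, rfl⟩ := List.mem_map.1 hB'
    simp at ht
  · rw [flat_mirror] at hx
    rw [letters_true_mirror]
    simpa using hx
  · rw [letters_true_mirror, letters_false_mirror]; simp

/-- A pair reads `x y` and then `y x`; the two middle runs merge. -/
theorem fits_mirror {x y : ℕ} (h : [x, y].Sublist (letters true (mirror a b))) :
    Fits (ltr x y) (alt true 3) (flat (mirror a b)) := by
  rw [letters_true_mirror] at h
  rw [flat_mirror]
  have h₁ := fits_of_nodup List.nodup_range h
  have h₂ := (fits_of_nodup (List.nodup_reverse.2 List.nodup_range)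
    (by simpa using h.reverse : [y, x].Sublist (List.range (a * b)).reverse)).ltr_swap
  exact Fits.collapse (q := [true]) (h₁.append h₂)

end Mirror

/-! ### The double recursion and its multiplicities -/

/-- Composition of a list with a middle list, followed by distribution over copies of `bot`. -/
def step (prev mid : ℕ → ℕ → List Block) (bot : Bool → List Block) : List Block :=
  shuffle bot 0 (compose (mid (numBlocks true (bot true)) (numBlocks false (bot false)))
    (prev (letters true (mid (numBlocks true (bot true)) (numBlocks false (bot false)))).length
      (numBlocks false (bot false))))

/-- The recursion for the lists of blocks with the lengths `a` (blocks tagged `true`) and `b`. -/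
def row (prev mid : ℕ → ℕ → List Block) : ℕ → ℕ → List Block
  | 0, _ => [(true, [])]
  | _ + 1, 0 => [(false, [])]
  | a + 1, b + 1 =>
    step prev mid fun t => bif t then row prev mid a (b + 1) else row prev mid (a + 1) b
termination_by a b => a + b

/-- The base of `row`: no letters, but one block of tag `t`, which can receive one inserted letter
and so starts the recursion. -/
theorem good_empty (K v : ℕ) (hK : 1 ≤ K) {t : Bool} {j : Bool → ℕ} (ht : j t = 0) :
    Good K v j [(t, [])] where
  nodup := by simp
  len := by simp [ht]
  first := by simp
  cover := by simp
  count := by simp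
  pair a b _ := Or.inl (pairOK_of_fits (k := 1) (Fits.of_forall (by simp [blk])) hK)

theorem good_singleton (K a b : ℕ) (hK : 1 ≤ K) : Good K 0 (dims a b) [(true, List.range a)] where
  nodup := by simp [List.nodup_range]
  len := by simp [dims]
  first := by simp
  cover := by simp
  count := by simp
  pair x y hxy := by
    by_cases hx : x ∈ List.range a
    · by_cases hy : y ∈ List.range a
      · have key : ∀ x y, x < y → y < a → [x, y].Sublist (List.range a) := by
          intro x y hxy hy
          have h := (List.range_sublist.2 hy : (List.range (y + 1)).Sublist (List.range a))
          refine List.Sublist.trans ?_ h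
          rw [List.range_succ]
          exact (List.singleton_sublist.2 (by simpa using hxy)).append (.refl [y])
        rw [List.mem_range] at hx hy
        rcases lt_or_gt_of_ne hxy with h | h
        · exact Or.inr (Or.inr (Or.inl ⟨[], _, [], rfl, key x y h hy, Fits.nil_right _,
            Fits.nil_right _⟩))
        · exact Or.inl (Or.inr (Or.inl ⟨[], _, [], rfl, key y x h hx, Fits.nil_right _,
            Fits.nil_right _⟩))
      · exact Or.inl (pairOK_of_fits (k := 1) (blk_of_notMem_right (by simpa using hy)) hK)
    · exact Or.inr (pairOK_of_fits (k := 1) (blk_of_notMem_right (by simpa using hx)) hK)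

/-- Each bottom list falls short by one in the length for its own tag, which is what insertion makes
up. The bounds on `K` are those of `pair_compose`, for shared `false` and `true` blocks
respectively. -/
theorem good_row {K r v u : ℕ} (hK : 5 ≤ K) (hr : 2 * r + 2 ≤ K) {prev mid : ℕ → ℕ → List Block}
    (hprev : ∀ a b, Good K u (dims a b) (prev a b)) (hmid : ∀ a b, Frame v (dims a b) (mid a b))
    (hfits : ∀ a b x y, [x, y].Sublist (letters true (mid a b)) →
      Fits (ltr x y) (alt true (2 * r + 1)) (flat (mid a b))) (a b : ℕ) :
    Good K (v + 2 * u) (dims a b) (row prev mid a b) := by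
  induction a generalizing b with
  | zero => rw [row]; exact good_empty _ _ (by omega) rfl
  | succ a iha =>
    induction b with
    | zero => rw [row]; exact good_empty _ _ (by omega) rfl
    | succ b ihb =>
      rw [row, step]
      set bot : Bool → List Block := fun t =>
        bif t then row prev mid a (b + 1) else row prev mid (a + 1) b with hbotdef
      set wA := numBlocks true (bot true)
      set wB := numBlocks false (bot false)
      have hbot : ∀ t, Good K (v + 2 * u) (bif t then dims a (b + 1) else dims (a + 1) b)
          (bot t) := by
        intro t
        cases t
        exacts [ihb, iha (b + 1)]
      have hC := frame_compose (hmid wA wB) (hprev (letters true (mid wA wB)).length wB).toFrame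
        rfl rfl
      have hw : ∀ t, dims wA wB t = numBlocks t (bot t) := by intro t; cases t <;> rfl
      have hpC : ∀ x y, x ≠ y → _ := fun x y hxy =>
        (hprev (letters true (mid wA wB)).length wB).pair x y hxy
      refine ⟨frame_shuffle hC hw (fun t => (hbot t).toFrame) (fun t t' => ?_) 0,
        fun x y hxy => pairOK_shuffle hK hC hw (fun t => (hbot t).toFrame) (fun x y hxy => ?_)
          (fun t => (hbot t).pair) hxy⟩
      · cases t <;> cases t' <;> rfl
      · rcases hpC x y hxy with h | h
        · exact pair_compose hK hr (hmid wA wB) (hfits wA wB)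
            (hprev (letters true (mid wA wB)).length wB).toFrame rfl h
        · exact (pair_compose hK hr (hmid wA wB) (hfits wA wB)
            (hprev (letters true (mid wA wB)).length wB).toFrame rfl h).symm

/-- Lists of blocks without alternations of length six. -/
def fourth : ℕ → ℕ → ℕ → List Block
  | 0 => fun a _ => [(true, List.range a)]
  | i + 1 => row (fourth i) mirror

/-- Lists of blocks without alternations of length seven. -/
def fifth : ℕ → ℕ → ℕ → List Block
  | 0 => fun a _ => [(true, List.range a)]
  | i + 1 => row (fifth i) (fourth (i + 1))

theorem good_fourth (i : ℕ) : ∃ v, v + 1 = 2 ^ i ∧ ∀ a b, Good 5 v (dims a b) (fourth i a b) := by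
  induction i with
  | zero => exact ⟨0, rfl, fun a b => good_singleton 5 a b (by norm_num)⟩
  | succ i ih =>
    obtain ⟨v, hv, h⟩ := ih
    refine ⟨1 + 2 * v, by rw [pow_succ]; omega, fun a b => ?_⟩
    exact good_row (r := 1) le_rfl (by norm_num) h frame_mirror
      (fun a b x y h => fits_mirror a b h) a b

/-- The middle list has multiplicity `2 ^ (i + 1) - 1`, so `u` becomes `2 * u + 2 ^ (i + 1) - 1`;
the additive form of the solution avoids truncated subtraction. The middle list has `2 * 2 + 1`
runs, which is why six runs are needed here. -/
theorem good_fifth (i : ℕ) :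
    ∃ v, v + 2 ^ i = i * 2 ^ i + 1 ∧ ∀ a b, Good 6 v (dims a b) (fifth i a b) := by
  induction i with
  | zero => exact ⟨0, rfl, fun a b => good_singleton 6 a b (by norm_num)⟩
  | succ i ih =>
    obtain ⟨u, hu, h⟩ := ih
    obtain ⟨v, hv, hfour⟩ := good_fourth (i + 1)
    refine ⟨v + 2 * u, ?_, fun a b => ?_⟩
    · rw [pow_succ] at hv ⊢
      have : (i + 1) * (2 ^ i * 2) = 2 * (i * 2 ^ i) + 2 * 2 ^ i := by ring
      omega
    · exact good_row (r := 2) (by norm_num) (by norm_num) h (fun a b => (hfour a b).toFrame)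
        (fun a b x y hxy => (hfour a b).fits_of_order le_rfl hxy) a b

/-! ### Ackermann's function and the size of the construction -/

theorem ackermann_one (j : ℕ) : ackermann 1 j = 2 ^ j := by rw [ackermann]

theorem ackermann_succ_one {k : ℕ} (hk : 1 ≤ k) : ackermann (k + 1) 1 = 2 := by
  obtain ⟨k, rfl⟩ := Nat.exists_eq_add_of_le' hk
  rw [ackermann]

theorem ackermann_succ_succ {k j : ℕ} (hk : 1 ≤ k) (hj : 1 ≤ j) :
    ackermann (k + 1) (j + 1) = ackermann (k + 1) j * ackermann k (ackermann (k + 1) j) := by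
  obtain ⟨k, rfl⟩ := Nat.exists_eq_add_of_le' hk
  obtain ⟨j, rfl⟩ := Nat.exists_eq_add_of_le' hj
  rw [ackermann]

theorem two_pow_le_ackermann {k j : ℕ} (hk : 1 ≤ k) (hj : 1 ≤ j) : 2 ^ j ≤ ackermann k j := by
  induction k, hk using Nat.le_induction generalizing j with
  | base => rw [ackermann_one]
  | succ k hk ih =>
    induction j, hj using Nat.le_induction with
    | base => rw [ackermann_succ_one hk]; norm_num
    | succ j hj ihj =>
      rw [ackermann_succ_succ hk hj, pow_succ]
      have h1 : 1 ≤ ackermann (k + 1) j := Nat.one_le_two_pow.trans ihj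
      exact Nat.mul_le_mul ihj ((Nat.pow_le_pow_right two_pos h1).trans (ih h1))

theorem ackermann_pos {k j : ℕ} (hk : 1 ≤ k) (hj : 1 ≤ j) : 1 ≤ ackermann k j :=
  Nat.one_le_two_pow.trans (two_pow_le_ackermann hk hj)

theorem le_ackermann {k j : ℕ} (hk : 1 ≤ k) (hj : 1 ≤ j) : j ≤ ackermann k j :=
  Nat.lt_two_pow_self.le.trans (two_pow_le_ackermann hk hj)

theorem ackermann_mono {k j j' : ℕ} (hk : 1 ≤ k) (hj : 1 ≤ j) (h : j ≤ j') :
    ackermann k j ≤ ackermann k j' := by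
  induction j', h using Nat.le_induction with
  | base => exact le_rfl
  | succ j' hj' ih =>
    refine ih.trans ?_
    obtain rfl | ⟨k, hk', rfl⟩ : k = 1 ∨ ∃ k', 1 ≤ k' ∧ k = k' + 1 := by
      rcases hk.eq_or_lt with h | h
      exacts [Or.inl h.symm, Or.inr ⟨k - 1, by omega, by omega⟩]
    · simp only [ackermann_one]
      exact Nat.pow_le_pow_right two_pos (by omega)
    · have hj1 : 1 ≤ j' := hj.trans hj'
      rw [ackermann_succ_succ hk' hj1]
      exact Nat.le_mul_of_pos_right _ (ackermann_pos hk' (ackermann_pos hk hj1))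

theorem ackermann_two {k : ℕ} (hk : 1 ≤ k) : ackermann k 2 = 2 ^ (k + 1) := by
  induction k, hk using Nat.le_induction with
  | base => rw [ackermann_one]
  | succ k hk ih =>
    rw [ackermann_succ_succ hk le_rfl, ackermann_succ_one hk, ih]; ring

theorem length_compose_le (M L : List Block) :
    (compose M L).length ≤ L.length * (M.length + 2) := by
  induction L with
  | nil => simp [compose]
  | cons B L ih =>
    rw [compose] at ih ⊢
    rw [List.flatMap_cons, List.length_append, List.length_cons, Nat.add_mul, Nat.one_mul]
    have : (expand M B).length ≤ M.length + 2 := by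
      rw [expand]
      split_ifs
      · simp [instantiate, mapLetters]
      · simp
    omega

/-- The argument grows by three per recursion step. With `w` bounding the bottom lists, the first
application of row `k` makes room for the argument `6 * w + 5`, the second bounds the middle list,
and the third the top list. -/
theorem length_row_le {k v : ℕ} (hk : 1 ≤ k) {prev mid : ℕ → ℕ → List Block}
    (hframe : ∀ a b, Frame v (dims a b) (mid a b))
    (hprev : ∀ a b z, a ≤ z → b ≤ z → (prev a b).length ≤ ackermann k (6 * z + 5))
    (hmid : ∀ a b z, a ≤ z → b ≤ z → (mid a b).length ≤ ackermann k (6 * z + 5)) (a b : ℕ) :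
    (row prev mid a b).length ≤ ackermann (k + 1) (5 + 3 * (a + b)) := by
  induction a generalizing b with
  | zero => rw [row]; exact ackermann_pos (by omega) (by omega)
  | succ a iha =>
    induction b with
    | zero => rw [row]; exact ackermann_pos (by omega) (by omega)
    | succ b ihb =>
      rw [row, step]
      set bot : Bool → List Block := fun t =>
        bif t then row prev mid a (b + 1) else row prev mid (a + 1) b with hbotdef
      set w := ackermann (k + 1) (5 + 3 * (a + b + 1)) with hw
      have hbot : ∀ t, (bot t).length ≤ w := by
        intro t
        cases t
        · exact ihb.trans_eq (by rw [hw]; congr 1; ring)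
        · exact (iha (b + 1)).trans_eq (by rw [hw]; congr 1)
      have hnum : ∀ t, numBlocks t (bot t) ≤ w := fun t =>
        (numBlocks_le_length t _).trans (hbot t)
      have hw32 : 5 ≤ w := le_trans (by omega) (le_ackermann (by omega) (by omega))
      set w₁ := w * ackermann k w with hw₁
      set g := ackermann k w₁ with hg
      set w₂ := w₁ * g with hw₂
      set h := ackermann k w₂ with hh
      have htarget : ackermann (k + 1) (5 + 3 * (a + 1 + (b + 1))) = w₂ * h := by
        rw [show 5 + 3 * (a + 1 + (b + 1)) = 5 + 3 * (a + b + 1) + 1 + 1 + 1 by ring,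
          ackermann_succ_succ hk (by omega), ackermann_succ_succ hk (by omega),
          ackermann_succ_succ hk (by omega)]
      have hw₁le : 6 * w + 5 ≤ w₁ := by
        have : 7 ≤ ackermann k w := le_trans (by norm_num)
          ((Nat.pow_le_pow_right two_pos hw32).trans (two_pow_le_ackermann hk (by omega)))
        calc 6 * w + 5 ≤ w * 7 := by omega
          _ ≤ w₁ := Nat.mul_le_mul_left _ this
      have hgpos : 1 ≤ g := ackermann_pos hk (by omega)
      set M := mid (numBlocks true (bot true)) (numBlocks false (bot false)) with hM
      have hMlen : M.length ≤ g := (hmid _ _ w (hnum true) (hnum false)).trans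
        (ackermann_mono hk (by omega) hw₁le)
      have hN : (letters true M).length ≤ g * w := by
        rw [length_letters (j := numBlocks true (bot true)) fun B hB ht => by
          rw [(hframe _ _).len B hB, ht]; rfl]
        exact Nat.mul_le_mul ((numBlocks_le_length _ _).trans hMlen) (hnum true)
      have hz : 6 * (g * w) + 5 ≤ w₂ := by
        calc 6 * (g * w) + 5 ≤ (6 * w + 5) * g := by nlinarith
          _ ≤ w₂ := Nat.mul_le_mul_right _ hw₁le
      have htop := (hprev (letters true M).length (numBlocks false (bot false)) (g * w) hN
        ((hnum false).trans (Nat.le_mul_of_pos_left _ hgpos))).trans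
        (ackermann_mono hk (by omega) hz)
      refine (length_shuffle_le hbot 0 _).trans ?_
      rw [htarget]
      have h₁ : (M.length + 2) * w ≤ w₂ := by
        calc (M.length + 2) * w ≤ (3 * g) * w := Nat.mul_le_mul_right _ (by omega)
          _ ≤ (6 * w + 5) * g := by nlinarith
          _ ≤ w₂ := Nat.mul_le_mul_right _ hw₁le
      calc _ ≤ (h * (M.length + 2)) * w :=
            Nat.mul_le_mul_right _ ((length_compose_le _ _).trans (Nat.mul_le_mul_right _ htop))
        _ = ((M.length + 2) * w) * h := by ring
        _ ≤ w₂ * h := Nat.mul_le_mul_right _ h₁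

theorem length_fourth_le (i a b z : ℕ) (ha : a ≤ z) (hb : b ≤ z) :
    (fourth i a b).length ≤ ackermann (i + 1) (6 * z + 5) := by
  induction i generalizing a b z with
  | zero => exact ackermann_pos le_rfl (by omega)
  | succ i ih =>
    refine (length_row_le (by omega) frame_mirror (fun a b z => ih a b z)
      (fun a b z ha hb => ?_) a b).trans (ackermann_mono (by omega) (by omega) (by omega))
    rw [length_mirror]
    exact le_trans (by omega) (le_ackermann (by omega) (by omega))

theorem length_fifth_le (i a b z : ℕ) (ha : a ≤ z) (hb : b ≤ z) :
    (fifth i a b).length ≤ ackermann (i + 2) (6 * z + 5) := by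
  induction i generalizing a b z with
  | zero => exact ackermann_pos (by omega) (by omega)
  | succ i ih =>
    obtain ⟨v, -, hv⟩ := good_fourth (i + 1)
    exact (length_row_le (by omega) (fun a b => (hv a b).toFrame) (fun a b z => ih a b z)
      (fun a b z => length_fourth_le (i + 1) a b z) a b).trans
      (ackermann_mono (by omega) (by omega) (by omega))

theorem pow_five_le_two_pow {w : ℕ} (hw : 32 ≤ w) : w ^ 5 ≤ 2 ^ (w - 1) := by
  induction w, hw using Nat.le_induction with
  | base => norm_num
  | succ w hw ih =>
    rw [show w + 1 - 1 = (w - 1) + 1 by omega, pow_succ]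
    have h : (w + 1) ^ 5 ≤ w ^ 5 * 2 := by
      have h4 : 32 * w ^ 4 ≤ w ^ 5 := by rw [pow_succ w 4, mul_comm]; gcongr
      have h3 : 32 * w ^ 3 ≤ w ^ 4 := by rw [pow_succ w 3, mul_comm]; gcongr
      have h2 : 32 * w ^ 2 ≤ w ^ 3 := by rw [pow_succ w 2, mul_comm]; gcongr
      have h1 : 32 * w ≤ w ^ 2 := by rw [pow_two]; gcongr
      have : (w + 1) ^ 5 = w ^ 5 + 5 * w ^ 4 + 10 * w ^ 3 + 10 * w ^ 2 + 5 * w + 1 := by ring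
      omega
    exact h.trans (Nat.mul_le_mul_right _ ih)

/-- A list without letters is a frame for trivial reasons, so nonemptiness needs its own induction.
Positive multiplicity ensures that there are `false` blocks as soon as there are letters. -/
theorem length_letters_row_pos {K r v u : ℕ} (hK : 5 ≤ K) (hr : 2 * r + 2 ≤ K)
    {prev mid : ℕ → ℕ → List Block}
    (hprev : ∀ a b, Good K u (dims a b) (prev a b)) (hmid : ∀ a b, Frame v (dims a b) (mid a b))
    (hfits : ∀ a b x y, [x, y].Sublist (letters true (mid a b)) →
      Fits (ltr x y) (alt true (2 * r + 1)) (flat (mid a b))) (hv : 0 < v + 2 * u)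
    (hprev' : ∀ a b, 0 < a → 0 < b → 0 < (letters true (prev a b)).length)
    (hmid' : ∀ a b, 0 < a → 0 < b → 0 < (letters true (mid a b)).length)
    (a b : ℕ) (ha : 0 < a) (hb : 0 < b) : 0 < (letters true (row prev mid a b)).length := by
  obtain ⟨a, rfl⟩ : ∃ a', a = a' + 1 := ⟨a - 1, by omega⟩
  obtain ⟨b, rfl⟩ : ∃ b', b = b' + 1 := ⟨b - 1, by omega⟩
  clear ha hb
  have hgood := good_row hK hr hprev hmid hfits
  have hpos : ∀ {t : Bool} {a b : ℕ}, 0 < (letters t (row prev mid a b)).length →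
      0 < numBlocks t (row prev mid a b) := by
    intro t a b h
    rw [length_letters fun B hB ht => by rw [(hgood a b).len B hB, ht]] at h
    exact Nat.pos_of_mul_pos_right h
  induction hs : a + b using Nat.strong_induction_on generalizing a b with
  | _ s ih =>
    have hA : 0 < numBlocks true (row prev mid a (b + 1)) := by
      cases a with
      | zero => rw [row]; simp [numBlocks]
      | succ a => exact hpos (ih (a + b) (by omega) a b rfl)
    have hB : 0 < numBlocks false (row prev mid (a + 1) b) := by
      cases b with
      | zero => rw [row]; simp [numBlocks]
      | succ b =>
        refine hpos ?_
        rw [(hgood (a + 1) (b + 1)).count]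
        exact Nat.mul_pos hv (ih (a + b) (by omega) a b rfl)
    rw [row, step]
    set bot : Bool → List Block := fun t =>
      bif t then row prev mid a (b + 1) else row prev mid (a + 1) b with hbotdef
    set wA := numBlocks true (bot true)
    set wB := numBlocks false (bot false)
    have hM := hmid' wA wB hA hB
    have htop := hprev' _ wB hM hB
    have hC := frame_compose (hmid wA wB) (hprev (letters true (mid wA wB)).length wB).toFrame
      rfl rfl
    have hlen := (length_letters_compose (L := prev (letters true (mid wA wB)).length wB)
      (hmid wA wB) fun B hB ht => by rw [(hprev _ wB).len B hB, ht]; rfl).1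
    obtain ⟨x, hx⟩ := List.exists_mem_of_length_pos (hlen ▸ htop)
    refine List.length_pos_of_mem (mem_letters_shuffle (fun B hB => ?_) hx)
    rw [hC.len B hB]
    cases B.1 <;> rfl

theorem length_letters_fourth_pos (i a b : ℕ) (ha : 0 < a) (hb : 0 < b) :
    0 < (letters true (fourth i a b)).length := by
  induction i generalizing a b with
  | zero => simpa [fourth] using ha
  | succ i ih =>
    obtain ⟨u, -, hu⟩ := good_fourth i
    refine length_letters_row_pos (r := 1) le_rfl (by norm_num) hu frame_mirror
      (fun a b x y h => fits_mirror a b h) (by omega) (fun a b => ih a b) (fun a b ha hb => ?_)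
      a b ha hb
    rw [letters_true_mirror, List.length_range]
    exact Nat.mul_pos ha hb

theorem length_letters_fifth_pos (i a b : ℕ) (ha : 0 < a) (hb : 0 < b) :
    0 < (letters true (fifth i a b)).length := by
  induction i generalizing a b with
  | zero => simpa [fifth] using ha
  | succ i ih =>
    obtain ⟨u, -, hu⟩ := good_fifth i
    obtain ⟨v, hv, hfour⟩ := good_fourth (i + 1)
    have hv' : 0 < v := by
      have : 0 < 2 ^ i := by positivity
      rw [pow_succ] at hv
      omega
    exact length_letters_row_pos (r := 2) (by norm_num) (by norm_num) hu
      (fun a b => (hfour a b).toFrame)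
      (fun a b x y hxy => (hfour a b).fits_of_order le_rfl hxy) (by omega) (fun a b => ih a b)
      (fun a b => length_letters_fourth_pos (i + 1) a b) a b ha hb

/-- Two rows of Ackermann's function absorb all the factors that occur. -/
theorem mul_ackermann_le {i j z : ℕ} (hj : 3 ≤ j) (hz : z ≤ 2 * j * (i * 2 ^ i)) :
    z * ackermann (i + 2) (6 * z + 5) * ((i + 5) * 2 ^ (i + 5)) ≤ ackermann (i + 4) j := by
  obtain ⟨j, rfl⟩ : ∃ j', j = j' + 1 := ⟨j - 1, by omega⟩
  rw [ackermann_succ_succ (k := i + 3) (j := j) (by omega) (by omega)]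
  set w := ackermann (i + 4) j with hw
  -- Here `j` is the old one minus one, hence at least two, and the second column already exceeds `2
  -- ^ (i + 5)`. This uses the `3` in the definition of `α`.
  have hwi : 2 ^ (i + 5) ≤ w := by
    rw [← ackermann_two (k := i + 4) (by omega)]
    exact ackermann_mono (by omega) (by omega) (by omega)
  have hwj : j + 1 ≤ w := Nat.lt_two_pow_self.trans_le (two_pow_le_ackermann (by omega) (by omega))
  have h32 : 32 ≤ w := le_trans (by
    calc 32 = 2 ^ 5 := by norm_num
      _ ≤ 2 ^ (i + 5) := Nat.pow_le_pow_right two_pos (by omega)) hwi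
  obtain ⟨u, hu⟩ : ∃ u, w = u + 1 := ⟨w - 1, by omega⟩
  have hsucc : ackermann (i + 3) w =
      ackermann (i + 3) u * ackermann (i + 2) (ackermann (i + 3) u) := by
    rw [hu]; exact ackermann_succ_succ (by omega) (by omega)
  rw [hsucc]
  set w' := ackermann (i + 3) u with hw'
  -- Three factors `w` pay for `z`, one for `i + 5` and one for `2 ^ (i + 5)`.
  have hw5 : w ^ 5 ≤ w' := by
    refine (pow_five_le_two_pow h32).trans ?_
    rw [hu, Nat.add_sub_cancel]
    exact two_pow_le_ackermann (by omega) (by omega)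
  have hpow : 32 * 2 ^ i ≤ w := by
    calc 32 * 2 ^ i = 2 ^ (i + 5) := by ring
      _ ≤ w := hwi
  have hi : i + 5 ≤ w := (Nat.lt_two_pow_self (n := i + 5)).le.trans hwi
  have hz' : 32 * z ≤ w ^ 3 := by
    calc 32 * z ≤ 32 * (2 * (j + 1) * (i * 2 ^ i)) := Nat.mul_le_mul_left _ hz
      _ = (j + 1) * (2 * i) * (32 * 2 ^ i) := by ring
      _ ≤ w * w * w := by
        gcongr
        have : i < 2 ^ i := Nat.lt_two_pow_self
        omega
      _ = w ^ 3 := by ring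
  have harg : 6 * z + 5 ≤ w' := by
    have h3 : w ^ 3 ≤ w ^ 5 := Nat.pow_le_pow_right (by omega) (by norm_num)
    have h1 : w ≤ w ^ 3 := Nat.le_self_pow (by norm_num) w
    omega
  calc z * ackermann (i + 2) (6 * z + 5) * ((i + 5) * 2 ^ (i + 5))
      ≤ w ^ 3 * ackermann (i + 2) w' * (w * w) := by
        gcongr
        · omega
        · exact ackermann_mono (by omega) (by omega) harg
    _ = w ^ 5 * ackermann (i + 2) w' := by ring
    _ ≤ w' * ackermann (i + 2) w' := Nat.mul_le_mul_right _ hw5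
    _ ≤ w * (w' * ackermann (i + 2) w') := Nat.le_mul_of_pos_left _ (by omega)

/-! ### Sequences with few runs, and their unions -/

/-- Any two letters form at most six runs. -/
def RunsLE (S : List ℕ) : Prop :=
  ∀ a b, a ≠ b → Fits (ltr a b) (alt true 6) S ∨ Fits (ltr b a) (alt true 6) S

theorem alternating_seven : alternating (5 + 2) = [0, 1, 0, 1, 0, 1, 0] := by decide

theorem occurs_alternating_iff {S : List ℕ} :
    Occurs (alternating (5 + 2)) S ↔ ∃ a b, a ≠ b ∧ [a, b, a, b, a, b, a].Sublist S := by
  rw [alternating_seven]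
  constructor
  · rintro ⟨τ, hτ, f, hf, rfl⟩
    exact ⟨f 0, f 1, fun h => zero_ne_one (hf (by simp) (by simp) h), hτ⟩
  · rintro ⟨a, b, hab, h⟩
    refine ⟨_, h, fun x => if x = 0 then a else b, ?_, by simp⟩
    intro x hx y hy hxy
    simp only [List.mem_cons, List.not_mem_nil, or_false, Set.mem_ofPred_eq] at hx hy
    have hx : x = 0 ∨ x = 1 := by omega
    have hy : y = 0 ∨ y = 1 := by omega
    rcases hx with rfl | rfl <;> rcases hy with rfl | rfl <;> simp_all [eq_comm]

/-- In an alternating sequence of two letters, a run that avoids one of them has length at most one.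
-/
theorem Fits.length_le {a b : ℕ} {p : List Bool} {l : List ℕ} (h : Fits (ltr a b) p l)
    (hl : ∀ x ∈ l, x = a ∨ x = b) (hc : l.IsChain (· ≠ ·)) : l.length ≤ p.length := by
  induction p generalizing l with
  | nil =>
    cases l with
    | nil => simp
    | cons x l =>
      have h₁ := h x (by simp) true
      have h₂ := h x (by simp) false
      rcases hl x (by simp) with rfl | rfl
      · exact absurd rfl h₂
      · exact absurd rfl h₁
  | cons c p ih =>
    obtain ⟨l₁, l₂, rfl, h₁, h₂⟩ := h
    have hc' := List.isChain_append.1 hc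
    have h₃ := ih h₂ (fun x hx => hl x (List.mem_append_right _ hx)) hc'.2.1
    have h₄ : l₁.length ≤ 1 := by
      rcases l₁ with _ | ⟨x, _ | ⟨y, l⟩⟩
      · simp
      · simp
      · have hxy : x ≠ y := (List.isChain_cons_cons.1 hc'.1).1
        have hx := h₁ x (by simp)
        have hy := h₁ y (by simp)
        have hx' := hl x (by simp)
        have hy' := hl y (by simp)
        cases c <;> simp only [ltr, cond_true, cond_false] at hx hy <;> omega
    simp only [List.length_append, List.length_cons]
    omega

theorem RunsLE.not_occurs {S : List ℕ} (h : RunsLE S) : ¬ Occurs (alternating (5 + 2)) S := by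
  rw [occurs_alternating_iff]
  rintro ⟨a, b, hab, hS⟩
  have hba := hab.symm
  rcases h a b hab with h | h
  · have := (h.sublist hS).length_le (by simp) (by simp [hab, hba])
    simp at this
  · have := (h.sublist hS).length_le (by simp) (by simp [hab, hba])
    simp at this

theorem RunsLE.map {S : List ℕ} (h : RunsLE S) {f : ℕ → ℕ} (hf : f.Injective) :
    RunsLE (S.map f) := by
  intro x y hxy
  by_cases hx : x ∈ S.map f
  · by_cases hy : y ∈ S.map f
    · obtain ⟨a, -, rfl⟩ := List.mem_map.1 hx
      obtain ⟨b, -, rfl⟩ := List.mem_map.1 hy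
      refine (h a b fun h => hxy (by rw [h])).imp (fun h => ?_) fun h => ?_ <;>
      · refine h.map _ fun z _ c hc hzc => hc ?_
        cases c <;> exact hf hzc
    · refine Or.inl (Fits.alt_le (k := 1) (Fits.of_forall fun z hz hzy => hy ?_) (by norm_num))
      rwa [show z = _ from hzy] at hz
  · refine Or.inr (Fits.alt_le (k := 1) (Fits.of_forall fun z hz hzy => hx ?_) (by norm_num))
    rwa [show z = _ from hzy] at hz

/-- Letters from different parts form two runs; a pair from one part is absent from the other, which
then fits the empty pattern. -/
theorem RunsLE.append {S T : List ℕ} (hS : RunsLE S) (hT : RunsLE T) (hd : S.Disjoint T) :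
    RunsLE (S ++ T) := by
  have free : ∀ {l : List ℕ} {a b : ℕ}, a ∉ l → b ∉ l → Fits (ltr a b) [] l := by
    intro l a b ha hb z hz c hzc
    cases c
    · exact ha ((show z = a from hzc) ▸ hz)
    · exact hb ((show z = b from hzc) ▸ hz)
  have excl : ∀ {l : List ℕ} {a b : ℕ} (c : Bool), (bif c then b else a) ∉ l →
      Fits (ltr a b) [c] l := fun c hc => Fits.of_forall fun z hz hzc => hc (hzc ▸ hz)
  intro a b hab
  by_cases haS : a ∈ S
  · have haT := fun h => hd haS h
    by_cases hbS : b ∈ S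
    · have hbT := fun h => hd hbS h
      refine (hS a b hab).imp (fun h => ?_) fun h => ?_
      · simpa using h.append (free haT hbT)
      · simpa using h.append (free hbT haT)
    · exact Or.inl (Fits.alt_le (k := 2) ((excl true hbS).append (excl false haT)) (by norm_num))
  · by_cases hbS : b ∈ S
    · have hbT := fun h => hd hbS h
      exact Or.inr (Fits.alt_le (k := 2) ((excl true haS).append (excl false hbT)) (by norm_num))
    · refine (hT a b hab).imp (fun h => ?_) fun h => ?_
      · simpa using (free haS hbS).append h
      · simpa using (free hbS haS).append h

theorem RunsLE.of_nodup {S : List ℕ} (h : S.Nodup) : RunsLE S := by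
  induction S with
  | nil => exact fun a b _ => Or.inl (Fits.nil_right _)
  | cons x S ih =>
    rw [List.nodup_cons] at h
    refine RunsLE.append (S := [x]) ?_ (ih h.2) (by simpa using h.1)
    intro a b hab
    by_cases hx : x = b
    · refine Or.inr (Fits.alt_le (k := 1) (Fits.of_forall fun z hz hzy => ?_) (by norm_num))
      rw [List.mem_singleton.1 hz, hx] at hzy
      exact hab hzy.symm
    · refine Or.inl (Fits.alt_le (k := 1) (Fits.of_forall fun z hz hzy => ?_) (by norm_num))
      rw [List.mem_singleton.1 hz] at hzy
      exact hx hzy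

/-- There is a sequence of length `l` over `n` letters, partitioned into at most `m` blocks, in
which any two letters form at most six runs. -/
def Realizable (n m l : ℕ) : Prop :=
  ∃ L : List (List ℕ), (∀ β ∈ L, β.Nodup) ∧ L.length ≤ m ∧ RunsLE L.flatten ∧
    L.flatten.toFinset.card = n ∧ L.flatten.length = l

theorem Realizable.mono {n m m' l : ℕ} (h : Realizable n m l) (hm : m ≤ m') :
    Realizable n m' l := by
  obtain ⟨L, h₁, h₂, h₃⟩ := h
  exact ⟨L, h₁, h₂.trans hm, h₃⟩

theorem toFinset_append_map_card {S T : List ℕ} {f g : ℕ → ℕ} (hf : f.Injective)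
    (hg : g.Injective) (hd : (S.map f).Disjoint (T.map g)) :
    (S.map f ++ T.map g).toFinset.card = S.toFinset.card + T.toFinset.card := by
  rw [List.toFinset_append,
    Finset.card_union_of_disjoint (List.disjoint_toFinset_iff_disjoint.2 hd)]
  have key : ∀ (l : List ℕ) {h : ℕ → ℕ}, h.Injective →
      (l.map h).toFinset.card = l.toFinset.card := by
    intro l h hh
    rw [← Finset.card_image_of_injective l.toFinset hh]
    congr 1
    ext x
    simp
  rw [key S hf, key T hg]

theorem double_injective : Function.Injective fun x : ℕ => 2 * x := fun x y h => by
  simp only at h; omega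

theorem double_add_one_injective : Function.Injective fun x : ℕ => 2 * x + 1 := fun x y h => by
  simp only at h; omega

theorem disjoint_even_odd (S T : List ℕ) :
    (S.map fun x => 2 * x).Disjoint (T.map fun x => 2 * x + 1) := by
  intro z hz hz'
  obtain ⟨x, -, rfl⟩ := List.mem_map.1 hz
  obtain ⟨y, -, h⟩ := List.mem_map.1 hz'
  omega

theorem Realizable.add {n m l n' m' l' : ℕ} (h : Realizable n m l) (h' : Realizable n' m' l') :
    Realizable (n + n') (m + m') (l + l') := by
  obtain ⟨L, h₁, h₂, h₃, h₄, h₅⟩ := h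
  obtain ⟨L', h₁', h₂', h₃', h₄', h₅'⟩ := h'
  refine ⟨L.map (List.map fun x => 2 * x) ++ L'.map (List.map fun x => 2 * x + 1), ?_, ?_, ?_, ?_,
    ?_⟩
  · intro β hβ
    rcases List.mem_append.1 hβ with hβ | hβ <;> obtain ⟨γ, hγ, rfl⟩ := List.mem_map.1 hβ
    · exact (h₁ γ hγ).map double_injective
    · exact (h₁' γ hγ).map double_add_one_injective
  · simp only [List.length_append, List.length_map]; omega
  all_goals rw [List.flatten_append, ← List.map_flatten, ← List.map_flatten]
  · exact (h₃.map double_injective).append (h₃'.map double_add_one_injective)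
      (disjoint_even_odd _ _)
  · rw [toFinset_append_map_card double_injective double_add_one_injective
      (disjoint_even_odd _ _), h₄, h₄']
  · rw [List.length_append, List.length_map, List.length_map, h₅, h₅']

theorem Realizable.nsmul {n m l : ℕ} (h : Realizable n m l) (k : ℕ) :
    Realizable (k * n) (k * m) (k * l) := by
  induction k with
  | zero => exact ⟨[], by simp, by simp, RunsLE.of_nodup (by simp), by simp, by simp⟩
  | succ k ih =>
    simp only [Nat.add_mul, Nat.one_mul]
    exact ih.add h

/-- Fresh letters can be added to the first block. -/
theorem Realizable.add_fresh {n m l : ℕ} (h : Realizable n m l) (hn : 1 ≤ n) (f : ℕ) :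
    Realizable (f + n) m (f + l) := by
  obtain ⟨L, h₁, h₂, h₃, h₄, h₅⟩ := h
  cases L with
  | nil => simp at h₄; omega
  | cons β L =>
    have hflat : (((List.range f).map (fun x => 2 * x) ++ β.map (fun x => 2 * x + 1)) ::
        L.map (List.map fun x => 2 * x + 1)).flatten =
        (List.range f).map (fun x => 2 * x) ++ (β :: L).flatten.map (fun x => 2 * x + 1) := by
      simp [List.map_flatten]
    refine ⟨((List.range f).map (fun x => 2 * x) ++ β.map (fun x => 2 * x + 1)) ::
      L.map (List.map fun x => 2 * x + 1), ?_, by simpa using h₂, ?_, ?_, ?_⟩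
    · intro γ hγ
      rcases List.mem_cons.1 hγ with rfl | hγ
      · exact (List.nodup_range.map double_injective).append
          ((h₁ β (by simp)).map double_add_one_injective) (disjoint_even_odd _ _)
      · obtain ⟨γ, hγ', rfl⟩ := List.mem_map.1 hγ
        exact (h₁ γ (List.mem_cons_of_mem _ hγ')).map double_add_one_injective
    all_goals rw [hflat]
    · exact ((RunsLE.of_nodup List.nodup_range).map double_injective).append
        (h₃.map double_add_one_injective) (disjoint_even_odd _ _)
    · rw [toFinset_append_map_card double_injective double_add_one_injective
        (disjoint_even_odd _ _), h₄, List.toFinset_card_of_nodup List.nodup_range,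
        List.length_range]
    · rw [List.length_append, List.length_map, List.length_map, h₅, List.length_range]

/-- One letter repeated in all blocks, and all other letters once. This settles small `α` and very
large `m`. -/
theorem realizable_trivial {n m : ℕ} (hn : 1 ≤ n) (hm : 1 ≤ m) : Realizable n m (n - 1 + m) := by
  have h : Realizable 1 m m := by
    have hflat : (List.replicate m [0]).flatten = List.replicate m 0 := by simp
    refine ⟨List.replicate m [0], fun β hβ => ?_, by simp, ?_, ?_, by simp⟩
    · rw [List.eq_of_mem_replicate hβ]; simp
    · rw [hflat]
      intro a b hab
      by_cases hb : b = 0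
      · refine Or.inr (Fits.alt_le (k := 1) (Fits.of_forall fun z hz hzy => ?_) (by norm_num))
        rw [List.eq_of_mem_replicate hz] at hzy
        exact hab (hzy.symm.trans hb.symm)
      · refine Or.inl (Fits.alt_le (k := 1) (Fits.of_forall fun z hz hzy => ?_) (by norm_num))
        rw [List.eq_of_mem_replicate hz] at hzy
        exact hb hzy.symm
    · rw [hflat, List.toFinset_replicate_of_ne_zero (by omega)]; simp
  have := h.add_fresh le_rfl (n - 1)
  rwa [Nat.sub_add_cancel hn] at this

theorem Good.realizable {v : ℕ} {j : Bool → ℕ} {L : List Block} (h : Good 6 v j L) :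
    Realizable (letters true L).length L.length ((1 + v) * (letters true L).length) := by
  have hflat : (L.map Prod.snd).flatten = flat L := by
    rw [flat, List.flatMap_def]
  refine ⟨L.map Prod.snd, fun β hβ => ?_, by simp, ?_, ?_, ?_⟩
  · obtain ⟨B, hB, rfl⟩ := List.mem_map.1 hβ
    exact h.nodup B hB
  · rw [hflat]
    exact fun a b hab => h.fits_flat (by norm_num) hab
  · rw [hflat, ← List.toFinset_card_of_nodup h.nodup_letters]
    congr 1
    ext x
    rw [List.mem_toFinset, List.mem_toFinset]
    exact ⟨h.cover x, fun hx => (letters_sublist_flat true L).subset hx⟩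
  · rw [hflat, length_flat, h.count]; ring

/-! ### The extremal functions, and from blocks to 2-sparseness -/

theorem length_le_of_hasBlocks {m : ℕ} {S : List ℕ} (h : HasBlocks m S) :
    S.length ≤ m * alphabetSize S := by
  obtain ⟨L, rfl, hm, hL⟩ := h
  rw [List.length_flatten]
  refine (List.sum_le_card_nsmul _ (alphabetSize L.flatten) fun k hk => ?_).trans ?_
  · obtain ⟨β, hβ, rfl⟩ := List.mem_map.1 hk
    rw [alphabetSize, ← List.toFinset_card_of_nodup (hL β hβ)]
    refine Finset.card_le_card fun x hx => ?_
    rw [List.mem_toFinset] at hx ⊢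
    exact List.mem_flatten.2 ⟨β, hβ, hx⟩
  · rw [List.length_map, smul_eq_mul]
    exact Nat.mul_le_mul_right _ hm

/-- The supremum of an unbounded set in `ℕ` is `0`, so lower bounds require boundedness. -/
theorem bddAbove_blocked (σ : List ℕ) (n m : ℕ) : BddAbove {l : ℕ | ∃ S : List ℕ,
    ¬ Occurs σ S ∧ alphabetSize S = n ∧ HasBlocks m S ∧ S.length = l} := by
  refine ⟨m * n, ?_⟩
  rintro l ⟨S, -, rfl, hS, rfl⟩
  exact length_le_of_hasBlocks hS

theorem Realizable.le_dsBlocked {n m l : ℕ} (h : Realizable n m l) : l ≤ dsBlocked 5 n m := by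
  obtain ⟨L, h₁, h₂, h₃, h₄, h₅⟩ := h
  exact le_csSup (bddAbove_blocked _ n m) ⟨L.flatten, h₃.not_occurs, h₄, ⟨L, rfl, h₂, h₁⟩, h₅⟩

/-- Removing repetitions at the boundaries of blocks. -/
theorem exists_chain_sublist (L : List (List ℕ)) (h : ∀ β ∈ L, β.Nodup) :
    ∃ S : List ℕ, S.Sublist L.flatten ∧ S.IsChain (· ≠ ·) ∧ (∀ x ∈ L.flatten, x ∈ S) ∧
      L.flatten.length ≤ S.length + L.length := by
  induction L with
  | nil => exact ⟨[], by simp⟩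
  | cons β L ih =>
    obtain ⟨S, hS, hc, hmem, hlen⟩ := ih fun β hβ => h β (List.mem_cons_of_mem _ hβ)
    have hβ : β.IsChain (· ≠ ·) := (h β (by simp)).isChain
    -- If the last letter of `β` equals the first letter of `S`, one of the two is dropped; this is
    -- the only loss, at most one letter per block.
    by_cases hcase : ∃ β' x T, β = β' ++ [x] ∧ S = x :: T
    · obtain ⟨β', x, T, rfl, rfl⟩ := hcase
      refine ⟨β' ++ x :: T, ?_, List.isChain_split.2 ⟨hβ, hc⟩, fun y hy => ?_, ?_⟩
      · rw [List.flatten_cons, List.append_assoc]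
        refine (List.Sublist.refl β').append ?_
        exact hS.trans (List.sublist_append_right _ _)
      · rw [List.flatten_cons, List.mem_append] at hy
        rcases hy with hy | hy
        · rcases List.mem_append.1 hy with hy | hy
          · exact List.mem_append_left _ hy
          · rw [List.mem_singleton.1 hy]; simp
        · exact List.mem_append_right _ (hmem y hy)
      · simp only [List.flatten_cons, List.length_append, List.length_cons, List.length_nil]
          at hlen ⊢
        omega
    · refine ⟨β ++ S, ?_, List.isChain_append.2 ⟨hβ, hc, ?_⟩, fun y hy => ?_, ?_⟩
      · rw [List.flatten_cons]
        exact (List.Sublist.refl β).append hS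
      · rintro x hx y hy rfl
        obtain ⟨β', rfl⟩ := List.getLast?_eq_some_iff.1 hx
        obtain ⟨T, rfl⟩ := List.head?_eq_some_iff.1 hy
        exact hcase ⟨β', x, T, rfl, rfl⟩
      · rw [List.flatten_cons, List.mem_append] at hy
        exact List.mem_append.2 (hy.imp id (hmem y))
      · simp only [List.flatten_cons, List.length_append, List.length_cons] at hlen ⊢
        omega

theorem isSparse_two_iff {S : List ℕ} : IsSparse 2 S ↔ S.IsChain (· ≠ ·) := by
  rw [List.isChain_iff_getElem]
  constructor
  · intro h i hi heq
    have := h ⟨i, by omega⟩ ⟨i + 1, hi⟩ (by simp) (by simpa using heq)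
    simp at this
  · intro h i k hik heq
    by_contra hlt
    have hik' : (i : ℕ) < k := hik
    have hk : (k : ℕ) = i + 1 := by omega
    refine h i (by have := k.2; omega) ?_
    simp only [List.get_eq_getElem] at heq
    rw [heq]
    congr 1

/-- The consecutive pairs of entries at the positions `0, 1`, then `2, 3`, and so on. -/
def toPairs : List ℕ → List (ℕ × ℕ)
  | x :: y :: l => (x, y) :: toPairs l
  | _ => []

theorem length_le_toPairs (l : List ℕ) : l.length ≤ 2 * (toPairs l).length + 1 := by
  induction l using toPairs.induct with
  | case1 x y l ih => simp only [toPairs, List.length_cons]; omega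
  | case2 l h =>
    rcases l with _ | ⟨x, _ | ⟨y, l⟩⟩
    · simp
    · simp
    · exact absurd rfl (h x y l)

theorem toPairs_sublist (l : List ℕ) :
    ((toPairs l).flatMap fun p => [p.1, p.2]).Sublist l := by
  induction l using toPairs.induct with
  | case1 x y l ih => simpa [toPairs] using ih
  | case2 l h => rw [toPairs]; · simp
                 · exact h

theorem ne_of_mem_toPairs {l : List ℕ} (hl : l.IsChain (· ≠ ·)) : ∀ p ∈ toPairs l, p.1 ≠ p.2 := by
  induction l using toPairs.induct with
  | case1 x y l ih =>
    rw [List.isChain_cons_cons] at hl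
    intro p hp
    rcases List.mem_cons.1 hp with rfl | hp
    · exact hl.1
    · exact ih hl.2.tail p hp
  | case2 l h => rw [toPairs]; · simp
                 · exact h

/-- The sequence is cut into disjoint adjacent pairs. An ordered pair of distinct letters that
appears four times would give `abababab`, so each appears at most three times. -/
theorem bddAbove_sparse (n : ℕ) : BddAbove {l : ℕ | ∃ S : List ℕ,
    ¬ Occurs (alternating (5 + 2)) S ∧ alphabetSize S = n ∧
      IsSparse (alphabetSize (alternating (5 + 2))) S ∧ S.length = l} := by
  refine ⟨2 * (n * n * 3) + 1, ?_⟩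
  rintro l ⟨S, hocc, rfl, hsp, rfl⟩
  have htwo : alphabetSize (alternating (5 + 2)) = 2 := by rw [alternating_seven]; rfl
  rw [htwo, isSparse_two_iff] at hsp
  refine (length_le_toPairs S).trans ?_
  have hsub := toPairs_sublist S
  have hcount : ∀ p ∈ (toPairs S).toFinset, (toPairs S).count p ≤ 3 := by
    intro p hp
    by_contra h
    have hrep : (List.replicate 4 p).Sublist (toPairs S) :=
      List.replicate_sublist_iff.2 (by omega)
    refine hocc (occurs_alternating_iff.2 ⟨p.1, p.2,
      ne_of_mem_toPairs hsp p (List.mem_toFinset.1 hp), ?_⟩)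
    refine List.Sublist.trans ?_ ((hrep.flatMap _).trans hsub)
    have : (List.replicate 4 p).flatMap (fun p => [p.1, p.2]) =
        [p.1, p.2, p.1, p.2, p.1, p.2, p.1] ++ [p.2] := rfl
    rw [this]
    exact List.sublist_append_left _ _
  have hlen : (toPairs S).length ≤ (toPairs S).toFinset.card * 3 := by
    rw [← List.sum_toFinset_count_eq_length]
    refine Finset.sum_le_card_nsmul _ _ _ fun p hp => ?_
    exact (le_of_eq (by congr!)).trans (hcount p hp)
  have hcard : (toPairs S).toFinset.card ≤ alphabetSize S * alphabetSize S := by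
    rw [alphabetSize, ← Finset.card_product]
    refine Finset.card_le_card fun p hp => ?_
    rw [List.mem_toFinset] at hp
    simp only [Finset.mem_product, List.mem_toFinset]
    exact ⟨hsub.subset (List.mem_flatMap.2 ⟨p, hp, by simp⟩),
      hsub.subset (List.mem_flatMap.2 ⟨p, hp, by simp⟩)⟩
  have := Nat.mul_le_mul_right 3 hcard
  omega

theorem le_dsSparse_of_blocks {n : ℕ} {L : List (List ℕ)} (hL : ∀ β ∈ L, β.Nodup)
    (hocc : ¬ Occurs (alternating (5 + 2)) L.flatten) (hn : alphabetSize L.flatten = n) :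
    L.flatten.length ≤ dsSparse 5 n + L.length := by
  obtain ⟨S, hS, hc, hmem, hlen⟩ := exists_chain_sublist L hL
  refine hlen.trans (Nat.add_le_add_right (le_csSup (bddAbove_sparse n) ⟨S, ?_, ?_, ?_, rfl⟩) _)
  · rw [occurs_alternating_iff] at hocc ⊢
    rintro ⟨a, b, hab, h⟩
    exact hocc ⟨a, b, hab, h.trans hS⟩
  · rw [← hn, alphabetSize, alphabetSize]
    congr 1
    ext x
    rw [List.mem_toFinset, List.mem_toFinset]
    exact ⟨fun h => hS.subset h, hmem x⟩
  · have htwo : alphabetSize (alternating (5 + 2)) = 2 := by rw [alternating_seven]; rfl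
    rw [htwo, isSparse_two_iff]
    exact hc

/-- Thinning an optimal sequence of at most `n` blocks costs at most `n` letters, and `n` distinct
letters in a row show that this loss is itself at most `dsSparse 5 n`. -/
theorem dsBlocked_le_two_mul_dsSparse {n : ℕ} (hn : 1 ≤ n) :
    dsBlocked 5 n n ≤ 2 * dsSparse 5 n := by
  have hne := (realizable_trivial hn hn).imp fun L h =>
    (⟨L.flatten, h.2.2.1.not_occurs, h.2.2.2.1, ⟨L, rfl, h.2.1, h.1⟩, h.2.2.2.2⟩ :
      ∃ S : List ℕ, ¬ Occurs (alternating (5 + 2)) S ∧ alphabetSize S = n ∧ HasBlocks n S ∧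
        S.length = n - 1 + n)
  have hmem := Nat.sSup_mem ⟨_, hne.choose_spec⟩ (bddAbove_blocked (alternating (5 + 2)) n n)
  obtain ⟨S, hocc, hS, ⟨L, rfl, hLn, hL⟩, hlen⟩ := hmem
  have h₁ : dsBlocked 5 n n ≤ dsSparse 5 n + L.length := by
    rw [dsBlocked, exBlocked, ← hlen]
    exact le_dsSparse_of_blocks hL hocc hS
  have h₂ : n ≤ dsSparse 5 n := by
    refine le_csSup (bddAbove_sparse n) ⟨List.range n,
      (RunsLE.of_nodup List.nodup_range).not_occurs, by
        rw [alphabetSize, List.toFinset_card_of_nodup List.nodup_range, List.length_range],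
      ?_, by simp⟩
    have htwo : alphabetSize (alternating (5 + 2)) = 2 := by rw [alternating_seven]; rfl
    rw [htwo, isSparse_two_iff]
    exact List.nodup_range.isChain
  omega

/-! ### Choice of parameters -/

theorem le_mul_dsBlocked {n m : ℕ} (hn : 1 ≤ n) (hm : 1 ≤ m) :
    n * (invAckermann₂ n m * 2 ^ invAckermann₂ n m) ≤ 768 * dsBlocked 5 n m := by
  have htriv := (realizable_trivial hn hm).le_dsBlocked
  by_cases hα : invAckermann₂ n m ≤ 5
  · have : invAckermann₂ n m * 2 ^ invAckermann₂ n m ≤ 5 * 2 ^ 5 :=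
      Nat.mul_le_mul hα (Nat.pow_le_pow_right two_pos hα)
    have := Nat.mul_le_mul_left n this
    omega
  set j := max ⌈(n : ℚ) / (m : ℚ)⌉₊ 3 with hj
  obtain ⟨i, hi⟩ : ∃ i, invAckermann₂ n m = i + 5 := ⟨invAckermann₂ n m - 5, by omega⟩
  have hi1 : 1 ≤ i := by omega
  -- Minimality of `α`: the index `α - 1` fails.
  have hack : ackermann (i + 4) j < m := by
    have hlt : i + 4 < invAckermann₂ n m := by omega
    have := Nat.notMem_of_lt_sInf hlt
    simp only [Set.mem_ofPred_eq, not_and, not_le] at this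
    exact this (by omega)
  have hnj : n ≤ m * j := by
    have h₁ : (n : ℚ) / m ≤ j :=
      (Nat.le_ceil _).trans (by exact_mod_cast le_max_left _ _)
    rw [div_le_iff₀ (by exact_mod_cast hm)] at h₁
    have h₂ : n ≤ j * m := by exact_mod_cast h₁
    rwa [mul_comm] at h₂
  have hj3 : 3 ≤ j := le_max_right _ _
  rw [hi]
  set Q := (i + 5) * 2 ^ (i + 5) with hQ
  -- With this many blocks the trivial sequence suffices. Otherwise `m ≤ n * Q`, which is needed to
  -- show `N < n`.
  by_cases hnm : n * Q < m
  · omega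
  obtain ⟨v, hv, hgood⟩ := good_fifth i
  have h2i : 2 ≤ 2 ^ i := by
    calc 2 = 2 ^ 1 := rfl
      _ ≤ 2 ^ i := Nat.pow_le_pow_right two_pos hi1
  have hii : 2 ^ i ≤ i * 2 ^ i := Nat.le_mul_of_pos_left _ hi1
  have hv1 : 1 ≤ v := by omega
  -- These lengths balance the tags: there are `N / (2 * j)` blocks of either tag, so `N / j` in
  -- all, the density permitted by `n ≤ m * j`.
  set L := fifth i (2 * j) (2 * j * v) with hL
  have hg := hgood (2 * j) (2 * j * v)
  rw [← hL] at hg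
  set N := (letters true L).length with hN
  have hNpos : 0 < N := length_letters_fifth_pos i _ _ (by omega) (Nat.mul_pos (by omega) hv1)
  have hA : N = numBlocks true L * (2 * j) :=
    length_letters fun B hB ht => by rw [hg.len B hB, ht]; rfl
  have hB : v * N = numBlocks false L * (2 * j * v) := by
    rw [← hg.count]
    exact length_letters fun B hB ht => by rw [hg.len B hB, ht]; rfl
  have hB' : N = numBlocks false L * (2 * j) := by
    refine Nat.eq_of_mul_eq_mul_left hv1 ?_
    rw [hB]; ring
  have hmj : L.length * j = N := by
    have h₁ : 2 * (L.length * j) = 2 * N := by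
      rw [← numBlocks_add]
      calc 2 * ((numBlocks true L + numBlocks false L) * j)
          = numBlocks true L * (2 * j) + numBlocks false L * (2 * j) := by ring
        _ = 2 * N := by omega
    omega
  have hNle : N ≤ (2 * j * v) * ackermann (i + 2) (6 * (2 * j * v) + 5) := by
    rw [hA, mul_comm]
    refine Nat.mul_le_mul (Nat.le_mul_of_pos_right _ hv1) ((numBlocks_le_length _ _).trans ?_)
    exact length_fifth_le i _ _ _ (Nat.le_mul_of_pos_right _ hv1) le_rfl
  have hNQ : N * Q < n * Q := by
    calc N * Q ≤ (2 * j * v) * ackermann (i + 2) (6 * (2 * j * v) + 5) * Q :=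
          Nat.mul_le_mul_right _ hNle
      _ ≤ ackermann (i + 4) j := mul_ackermann_le hj3 (Nat.mul_le_mul_left _ (by omega))
      _ < n * Q := by omega
  have hNn : N < n := lt_of_mul_lt_mul_right hNQ (Nat.zero_le _)
  -- Disjoint copies use more than half of the `n` letters; the remaining ones are added as fresh
  -- letters at no cost in blocks.
  set k := n / N with hk
  have hk1 : 1 ≤ k := Nat.div_pos hNn.le hNpos
  have hkn : k * N ≤ n := Nat.div_mul_le_self n N
  have hkn' : n < 2 * (k * N) := by
    have h₁ : n < k * N + N := by
      have := Nat.lt_div_mul_add (a := n) hNpos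
      exact this
    have h₂ : N ≤ k * N := Nat.le_mul_of_pos_left _ hk1
    omega
  have hkm : k * L.length ≤ m := by
    refine Nat.le_of_mul_le_mul_right (c := j) ?_ (by omega)
    calc k * L.length * j = k * N := by rw [mul_assoc, hmj]
      _ ≤ m * j := hkn.trans hnj
  have hreal := (hg.realizable.nsmul k).mono hkm
  have hreal' := (hreal.add_fresh (Nat.mul_pos hk1 hNpos) (n - k * N)).le_dsBlocked
  rw [← hN, Nat.sub_add_cancel hkn] at hreal'
  -- Here `Q` is `32 * (i + 5) * 2 ^ i`, against `1 + v = (i - 1) * 2 ^ i + 2`. The case `i = 1`,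
  -- where the leading term of `v` vanishes, is checked separately.
  have hvQ : Q ≤ 384 * (1 + v) := by
    have hQ' : Q = 32 * (i * 2 ^ i) + 160 * 2 ^ i := by rw [hQ]; ring
    rcases hi1.eq_or_lt with rfl | hi2
    · omega
    · have : 2 * 2 ^ i ≤ i * 2 ^ i := Nat.mul_le_mul_right _ hi2
      omega
  calc n * Q ≤ (2 * (k * N)) * (384 * (1 + v)) := Nat.mul_le_mul hkn'.le hvQ
    _ = 768 * (k * ((1 + v) * N)) := by ring
    _ ≤ 768 * dsBlocked 5 n m := Nat.mul_le_mul_left _ (by omega)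

end DavenportSchinzel

theorem mainTheorem3 :
    (∃ c : ℝ, 0 < c ∧ ∀ n m : ℕ, 1 ≤ n → 1 ≤ m →
      c * ((n : ℝ) * (DavenportSchinzel.invAckermann₂ n m : ℝ) *
          (2 : ℝ) ^ DavenportSchinzel.invAckermann₂ n m)
        ≤ (DavenportSchinzel.dsBlocked 5 n m : ℝ)) ∧
    (∃ c : ℝ, 0 < c ∧ ∀ n : ℕ, 1 ≤ n →
      c * ((n : ℝ) * (DavenportSchinzel.invAckermann n : ℝ) *
          (2 : ℝ) ^ DavenportSchinzel.invAckermann n)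
        ≤ (DavenportSchinzel.dsSparse 5 n : ℝ)) := by
  have key : ∀ n m : ℕ, 1 ≤ n → 1 ≤ m →
      (n : ℝ) * (DavenportSchinzel.invAckermann₂ n m : ℝ) *
        (2 : ℝ) ^ DavenportSchinzel.invAckermann₂ n m ≤
        768 * (DavenportSchinzel.dsBlocked 5 n m : ℝ) := by
    intro n m hn hm
    rw [mul_assoc]
    exact_mod_cast DavenportSchinzel.le_mul_dsBlocked hn hm
  refine ⟨⟨1 / 768, by norm_num, fun n m hn hm => ?_⟩, 1 / 1536, by norm_num, fun n hn => ?_⟩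
  · have := key n m hn hm
    linarith
  · have h₁ := key n n hn hn
    have h₂ : (DavenportSchinzel.dsBlocked 5 n n : ℝ) ≤ 2 * DavenportSchinzel.dsSparse 5 n := by
      exact_mod_cast DavenportSchinzel.dsBlocked_le_two_mul_dsSparse hn
    rw [DavenportSchinzel.invAckermann]
    linarith
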